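/- Let $\mathscr{L}$ be a real separable infinite-dimensional Hilbert space, $(\Omega,\mathcal{F},\mathbb{P})$ a probability space, and $\Phi:\mathscr{L}\to L^2(\Omega,\mathbb{P})$ a Gaussian field: $\Phi$ is linear into real $L^2$, and $(\Phi(h))_{h\in\mathscr{L}}$ is a centered jointly Gaussian family with $\mathbb{E}(\Phi(h)\Phi(k))=\langle h,k\rangle$. Assume that $\mathcal{F}$ is generated by $\{\Phi(h):h\in\mathscr{L}\}$ up to $\mathbb{P}$-null sets. Let $\mathscr{D}\subset L^2(\Omega,\mathbb{P})$ be the space of polynomial random variables $F=p(\Phi(h_1),\dots,\Phi(h_n))$ ($n\ge 0$, $h_j\in\mathscr{L}$, $p\in\mathbb{R}[x_1,\dots,x_n]$), and let $T$ be the Malliavin derivative, i.e. the operator from $L^2(\Omega,\mathbb{P})$ to $L^2(\Omega\to\mathscr{L},\mathbb{P})=L^2(\Omega,\mathbb{P})\otimes\mathscr{L}$ with domain $\mathscr{D}$ and $$T\big(p(\Phi(h_1),\dots,\Phi(h_n))\big)=\sum_{j=1}^n \frac{\partial p}{\partial x_j}(\Phi(h_1),\dots,\Phi(h_n))\otimes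 h_j .$$ For $k\in\mathscr{L}$ let $T_k F=\langle T F,k\rangle_{\mathscr{L}}$, $F\in\mathscr{D}$. Bars denote closures of operators and stars denote Hilbert space adjoints; a product $BA$ of unbounded operators has domain $\{F\in dom(A): AF\in dom(B)\}$, and a sum $\sum_i A_i$ has as domain the set of all $F\in\bigcap_i dom(A_i)$ for which $\sum_i A_iF$ converges unconditionally in norm. Then $T$ is well defined, densely defined and closable, every $T_k$ is closable, and for every orthonormal basis $\{e_i\}_{i\in\mathbb{N}}$ of $\mathscr{L}$: 1. $T^*\overline{T}$ is selfadjoint. 2. $T^*\overline{T}=N$, with equality of domains, where $N:=\sum_i T_{e_i}^*\,\overline{T_{e_i}}$ is the CCR number operator. 3. If the $T_{e_i}$ are taken on their original domain $\mathscr{D}$, then the operator $\sum_i T_{e_i}^*T_{e_i}$ has domain exactly $\mathscr{D}$, is closable, and its closure is $T^*\overline{T}$. 4. For every $k\in\mathscr{L}$, $e^{\Phi(k)}$ lies in the domains of $T^*\overline{T}$ and of $N$, and $$T^*\overline{T}\,e^{\Phi(k)}=N e^{\Phi(k)}=\big(\Phi(k)-\|k\|^2\big)e^{\Phi(k)} .$$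 -/

import Mathlib

open MeasureTheory ProbabilityTheory
open scoped InnerProductSpace

noncomputable section

namespace GaussianField

/-! ### Unbounded operators -/

section Unbounded

variable {E F G : Type*} [AddCommGroup E] [Module ℝ E] [AddCommGroup F] [Module ℝ F]
  [AddCommGroup G] [Module ℝ G]

/-- The domain `{x ∈ dom f : f x ∈ dom g}` of the product `g f` of two unbounded operators. -/
def prodDomain (g : F →ₗ.[ℝ] G) (f : E →ₗ.[ℝ] F) : Submodule ℝ E :=
  (g.domain.comap f.toFun).map f.domain.subtype

theorem mem_prodDomain {g : F →ₗ.[ℝ] G} {f : E →ₗ.[ℝ] F} {x : E} :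
    x ∈ prodDomain g f ↔ ∃ hx : x ∈ f.domain, f ⟨x, hx⟩ ∈ g.domain := by
  simp only [prodDomain, Submodule.mem_map, Submodule.mem_comap, Submodule.subtype_apply]
  constructor
  · rintro ⟨y, hy, rfl⟩
    exact ⟨y.2, hy⟩
  · rintro ⟨hx, h⟩
    exact ⟨⟨x, hx⟩, h, rfl⟩

/-- The product `g f` of two unbounded operators, `x ↦ g (f x)` on its natural domain
`{x ∈ dom f : f x ∈ dom g}`. -/
def opMul (g : F →ₗ.[ℝ] G) (f : E →ₗ.[ℝ] F) : E →ₗ.[ℝ] G where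
  domain := prodDomain g f
  toFun :=
    { toFun := fun x =>
        g ⟨f ⟨x, (mem_prodDomain.1 x.2).choose⟩, (mem_prodDomain.1 x.2).choose_spec⟩
      map_add' := fun x y => by
        rw [← LinearPMap.map_add]
        congr 1
        exact Subtype.ext (LinearPMap.map_add f ⟨x, (mem_prodDomain.1 x.2).choose⟩
          ⟨y, (mem_prodDomain.1 y.2).choose⟩)
      map_smul' := fun c x => by
        rw [RingHom.id_apply, ← LinearPMap.map_smul]
        congr 1
        exact Subtype.ext (LinearPMap.map_smul f c ⟨x, (mem_prodDomain.1 x.2).choose⟩) }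

theorem opMul_domain (g : F →ₗ.[ℝ] G) (f : E →ₗ.[ℝ] F) :
    (opMul g f).domain = prodDomain g f := rfl

theorem opMul_apply (g : F →ₗ.[ℝ] G) (f : E →ₗ.[ℝ] F) (x : (opMul g f).domain)
    (hx : (x : E) ∈ f.domain) (h : f ⟨x, hx⟩ ∈ g.domain) :
    opMul g f x = g ⟨f ⟨x, hx⟩, h⟩ := rfl

end Unbounded

section Series

variable {ι E F : Type*} [AddCommGroup E] [Module ℝ E] [NormedAddCommGroup F] [NormedSpace ℝ F]

/-- The domain of the strong sum `∑ i, A i` of unbounded operators: those `x` that lie in the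
domain of every `A i` and for which the series `∑ i, A i x` converges in norm. -/
def seriesDomain (A : ι → E →ₗ.[ℝ] F) : Submodule ℝ E where
  carrier := {x | ∃ h : ∀ i, x ∈ (A i).domain, Summable fun i => A i ⟨x, h i⟩}
  zero_mem' := by
    refine ⟨fun i => (A i).domain.zero_mem, ?_⟩
    have h0 : (fun i => A i ⟨0, (A i).domain.zero_mem⟩) = fun _ => (0 : F) :=
      funext fun i => (A i).map_zero
    rw [h0]
    exact summable_zero
  add_mem' := by
    rintro x y ⟨hx, sx⟩ ⟨hy, sy⟩
    refine ⟨fun i => (A i).domain.add_mem (hx i) (hy i), ?_⟩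
    have h0 : (fun i => A i ⟨x + y, (A i).domain.add_mem (hx i) (hy i)⟩)
        = fun i => A i ⟨x, hx i⟩ + A i ⟨y, hy i⟩ :=
      funext fun i => (A i).map_add ⟨x, hx i⟩ ⟨y, hy i⟩
    rw [h0]
    exact sx.add sy
  smul_mem' := by
    rintro c x ⟨hx, sx⟩
    refine ⟨fun i => (A i).domain.smul_mem c (hx i), ?_⟩
    have h0 : (fun i => A i ⟨c • x, (A i).domain.smul_mem c (hx i)⟩)
        = fun i => c • A i ⟨x, hx i⟩ :=
      funext fun i => (A i).map_smul c ⟨x, hx i⟩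
    rw [h0]
    exact sx.const_smul c

/-- The strong sum `∑ i, A i` of a family of unbounded operators, `x ↦ ∑ i, A i x`, on its natural
(maximal) domain. -/
def opSeries (A : ι → E →ₗ.[ℝ] F) : E →ₗ.[ℝ] F where
  domain := seriesDomain A
  toFun :=
    { toFun := fun x => ∑' i, A i ⟨x, x.2.choose i⟩
      map_add' := fun x y => by
        rw [← x.2.choose_spec.tsum_add y.2.choose_spec]
        exact tsum_congr fun i => (A i).map_add ⟨x, x.2.choose i⟩ ⟨y, y.2.choose i⟩
      map_smul' := fun c x => by
        rw [RingHom.id_apply, ← x.2.choose_spec.tsum_const_smul c]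
        exact tsum_congr fun i => (A i).map_smul c ⟨x, x.2.choose i⟩ }

theorem opSeries_hasSum (A : ι → E →ₗ.[ℝ] F) (x : (opSeries A).domain)
    (h : ∀ i, (x : E) ∈ (A i).domain) :
    HasSum (fun i => A i ⟨x, h i⟩) (opSeries A x) :=
  x.2.choose_spec.hasSum

end Series

/-! ### Gaussian fields and the Malliavin derivative -/

variable {L Ω : Type*} [NormedAddCommGroup L] [InnerProductSpace ℝ L] [MeasurableSpace Ω]
  {P : Measure Ω}

/-- A Gaussian field over the real Hilbert space `L`: a linear map `Φ : L → L²(Ω, P)` such that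
`(Φ h)_{h ∈ L}` is a centered (jointly) Gaussian process with covariance
`𝔼 (Φ h * Φ k) = ⟪h, k⟫`. -/
structure IsGaussianField (Φ : L →ₗ[ℝ] Lp ℝ 2 P) : Prop where
  gaussian : IsGaussianProcess (fun (h : L) (ω : Ω) => Φ h ω) P
  mean : ∀ h : L, ∫ ω, Φ h ω ∂P = 0
  covariance : ∀ h k : L, ∫ ω, Φ h ω * Φ k ω ∂P = ⟪h, k⟫_ℝ

/-- The σ-algebra on `Ω` is the one generated by the random variables `Φ h`, `h ∈ L`,
up to `P`-null sets. -/
def GeneratesSigmaAlgebra (Φ : L →ₗ[ℝ] Lp ℝ 2 P) : Prop :=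
  ∀ A : Set Ω, MeasurableSet A →
    ∃ B : Set Ω,
      MeasurableSet[⨆ h : L, MeasurableSpace.comap (fun ω => Φ h ω) (borel ℝ)] B ∧ A =ᵐ[P] B

/-- The random variable `p (Φ h₁, …, Φ hₙ)`, for a polynomial `p` in `n` real variables. -/
def polyFun (Φ : L →ₗ[ℝ] Lp ℝ 2 P) {n : ℕ} (h : Fin n → L) (p : MvPolynomial (Fin n) ℝ) :
    Ω → ℝ :=
  fun ω => MvPolynomial.eval (fun j => Φ (h j) ω) p

/-- The `L`-valued random variable `∑ j, (∂p/∂xⱼ) (Φ h₁, …, Φ hₙ) ⊗ hⱼ`. -/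
def polyGrad (Φ : L →ₗ[ℝ] Lp ℝ 2 P) {n : ℕ} (h : Fin n → L) (p : MvPolynomial (Fin n) ℝ) :
    Ω → L :=
  fun ω => ∑ j, polyFun Φ h (MvPolynomial.pderiv j p) ω • h j

/-- The graph of the Malliavin derivative, as a subspace of `L²(Ω, P) × L²(Ω → L, P)`: it is
spanned by the pairs of `p (Φ h₁, …, Φ hₙ)` and `∑ j, (∂p/∂xⱼ) (Φ h₁, …, Φ hₙ) ⊗ hⱼ`. -/
def malliavinGraph (Φ : L →ₗ[ℝ] Lp ℝ 2 P) : Submodule ℝ (Lp ℝ 2 P × Lp L 2 P) :=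
  Submodule.span ℝ {FG | ∃ (n : ℕ) (h : Fin n → L) (p : MvPolynomial (Fin n) ℝ),
    FG.1 =ᵐ[P] polyFun Φ h p ∧ FG.2 =ᵐ[P] polyGrad Φ h p}

/-- The Malliavin derivative `T : L²(Ω, P) → L²(Ω → L, P)`, with domain the space `𝒟` of polynomial
random variables. -/
def malliavin (Φ : L →ₗ[ℝ] Lp ℝ 2 P) : Lp ℝ 2 P →ₗ.[ℝ] Lp L 2 P :=
  (malliavinGraph Φ).toLinearPMap

/-- The Malliavin derivative `T_k F = ⟨T F, k⟩` in the direction `k`, with domain `𝒟`. -/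
def malliavinDir (Φ : L →ₗ[ℝ] Lp ℝ 2 P) (k : L) : Lp ℝ 2 P →ₗ.[ℝ] Lp ℝ 2 P :=
  ((innerSL ℝ k).compLpL 2 P).toLinearMap.compPMap (malliavin Φ)

variable [CompleteSpace L]

/-- The operator `T* T̄`, where `T̄` is the closure of the Malliavin derivative `T`. -/
def adjMulClosure (Φ : L →ₗ[ℝ] Lp ℝ 2 P) : Lp ℝ 2 P →ₗ.[ℝ] Lp ℝ 2 P :=
  opMul (malliavin Φ).adjoint (malliavin Φ).closure

/-- The CCR number operator `N = ∑ i, T_{eᵢ}* T_{eᵢ}` of an orthonormal basis, where the factors on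
the right are the closed directional derivatives; its domain is the natural one. -/
def numberOp (Φ : L →ₗ[ℝ] Lp ℝ 2 P) (e : HilbertBasis ℕ ℝ L) : Lp ℝ 2 P →ₗ.[ℝ] Lp ℝ 2 P :=
  opSeries fun i => opMul (malliavinDir Φ (e i)).adjoint (malliavinDir Φ (e i)).closure

/-- The operator `∑ i, T_{eᵢ}* T_{eᵢ}` formed with the directional derivatives on their original
domain `𝒟`. -/
def numberOpPoly (Φ : L →ₗ[ℝ] Lp ℝ 2 P) (e : HilbertBasis ℕ ℝ L) : Lp ℝ 2 P →ₗ.[ℝ] Lp ℝ 2 P :=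
  opSeries fun i => opMul (malliavinDir Φ (e i)).adjoint (malliavinDir Φ (e i))

end GaussianField

end

/-! Selfadjointness is von Neumann's theorem: projecting `(z, 0)` onto the closed graph of `T̄`
shows that `1 + T* T̄` is onto, and a symmetric `B` with `1 + B` onto is selfadjoint.

On polynomials the problem is algebra. Polynomial random variables are lifted to `ℝ[X_h : h ∈ L]`,
where `dirDeriv k` and `creation k` satisfy the canonical commutation relations. Gaussian
integration by parts (`integral_mul_polyEval`) says that `creation k` is the `L²` adjoint of
`dirDeriv k`. Together with density of the polynomials (`denseRange_polyLp`) this makes the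
derivatives well defined and closable. Both `T* T` and `∑ T_{eᵢ}* T_{eᵢ}` then send `q (Φ h₁, …, Φ
hₙ)` to `∑ⱼ creation (h j) (∂ⱼ q)`. This is the Euler operator minus a term that lowers the degree,
so adding the identity gives a map onto the polynomials (`exists_add_number`). As `T* T̄ ≥ 0`, the
norm of `u` is at most that of `(1 + T* T̄) u`, hence `𝒟` is a core for `T* T̄`.

To compare with `N`, the limit from the core has to pass through an infinite sum. For orthogonal
`a`, `b` the terms `creation a (D_a p)` and `creation b (D_b p)` have inner product `‖D_a D_b p‖² ≥
0`, so every finite partial sum is bounded by the whole sum. This uniform bound gives `T* T̄ ≤ N`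
(`le_opSeries`). Since `N` is symmetric and a selfadjoint operator has no proper symmetric
extension, equality follows. The exponential is reached through its Taylor polynomials and
closedness of the graph. -/

namespace GaussianField

/-! ### Von Neumann's theorem, cores, and strong sums of unbounded operators. -/

section OperatorTheory

variable {H K : Type*} [NormedAddCommGroup H] [InnerProductSpace ℝ H]
  [NormedAddCommGroup K] [InnerProductSpace ℝ K]

theorem inner_adjoint_closure [CompleteSpace H] {A : H →ₗ.[ℝ] K} (hd : Dense (A.domain : Set H))
    (hc : A.IsClosable) (y : A.adjoint.domain) (x : A.closure.domain) :
    ⟪A.adjoint y, (x : H)⟫_ℝ = ⟪(y : K), A.closure x⟫_ℝ := by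
  have hx : ((x : H), A.closure x) ∈ closure (A.graph : Set (H × K)) := by
    have := A.closure.mem_graph x
    rw [← hc.graph_closure_eq_closure_graph] at this
    exact this
  have hcl : IsClosed {z : H × K | ⟪A.adjoint y, z.1⟫_ℝ = ⟪(y : K), z.2⟫_ℝ} :=
    isClosed_eq (by fun_prop) (by fun_prop)
  refine closure_minimal ?_ hcl hx
  rintro ⟨a, b⟩ hab
  obtain ⟨z, hz⟩ := (A.mem_graph_iff).1 hab
  simp only at hz
  simp only [Set.mem_ofPred_eq, ← hz.1, ← hz.2]
  exact A.adjoint_isFormalAdjoint hd y z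

/-- Let `(x, Āx)` be the orthogonal projection of `(z, 0)` onto the closed graph. The residual `(z -
x, -Āx)` is orthogonal to the graph, which says exactly that `A* Ā x = z - x`. The product carries
its Hilbert norm through `WithLp 2`. -/
theorem exists_add_adjoint_closure_eq [CompleteSpace H] [CompleteSpace K] {A : H →ₗ.[ℝ] K}
    (hd : Dense (A.domain : Set H)) (hc : A.IsClosable) (z : H) :
    ∃ x : (opMul A.adjoint A.closure).domain, (x : H) + opMul A.adjoint A.closure x = z := by
  let e : WithLp 2 (H × K) ≃L[ℝ] H × K := WithLp.prodContinuousLinearEquiv 2 ℝ H K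
  let Γ : Submodule ℝ (WithLp 2 (H × K)) := A.closure.graph.comap e.toLinearMap
  have hΓ : IsClosed (Γ : Set (WithLp 2 (H × K))) :=
    hc.closure_isClosed.preimage e.continuous
  have : CompleteSpace Γ := hΓ.completeSpace_coe
  let w : WithLp 2 (H × K) := WithLp.toLp 2 (z, 0)
  have hmem : Γ.starProjection w ∈ Γ := Submodule.starProjection_apply_mem Γ w
  obtain ⟨x, hx1, hx2⟩ := (A.closure.mem_graph_iff).1
    (show ((Γ.starProjection w).fst, (Γ.starProjection w).snd) ∈ A.closure.graph from hmem)
  have horth : ∀ v : A.closure.domain,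
      ⟪z - x, (v : H)⟫_ℝ = ⟪A.closure x, A.closure v⟫_ℝ := by
    intro v
    have hv : (WithLp.toLp 2 ((v : H), A.closure v)) ∈ Γ := A.closure.mem_graph v
    have h0 := Submodule.starProjection_inner_eq_zero (K := Γ) w _ hv
    simp only at hx1 hx2
    rw [WithLp.prod_inner_apply] at h0
    simp only [w, WithLp.ofLp_sub, Prod.fst_sub, Prod.snd_sub] at h0
    change ⟪z - (Γ.starProjection w).fst, (v : H)⟫_ℝ +
      ⟪0 - (Γ.starProjection w).snd, A.closure v⟫_ℝ = 0 at h0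
    rw [← hx1, ← hx2, zero_sub, inner_neg_left] at h0
    linarith
  have hle := A.le_closure
  have horth' : ∀ v : A.domain, ⟪z - x, (v : H)⟫_ℝ = ⟪A.closure x, A v⟫_ℝ := by
    intro v
    rw [horth ⟨v, hle.1 v.2⟩, hle.2 (x := v) (y := ⟨v, hle.1 v.2⟩) rfl]
  have hdom : A.closure x ∈ A.adjoint.domain := A.mem_adjoint_domain_of_exists _ ⟨_, horth'⟩
  have hx : (x : H) ∈ (opMul A.adjoint A.closure).domain := mem_prodDomain.2 ⟨x.2, hdom⟩
  refine ⟨⟨x, hx⟩, ?_⟩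
  rw [opMul_apply A.adjoint A.closure ⟨x, hx⟩ x.2 hdom,
    LinearPMap.adjoint_apply_eq hd ⟨_, hdom⟩ horth']
  simp

theorem inner_opMul_adjoint_closure [CompleteSpace H] {A : H →ₗ.[ℝ] K}
    (hd : Dense (A.domain : Set H)) (hc : A.IsClosable)
    (x : (opMul A.adjoint A.closure).domain) (y : A.closure.domain) :
    ⟪opMul A.adjoint A.closure x, (y : H)⟫_ℝ =
      ⟪A.closure ⟨x, (mem_prodDomain.1 x.2).choose⟩, A.closure y⟫_ℝ :=
  inner_adjoint_closure hd hc ⟨_, (mem_prodDomain.1 x.2).choose_spec⟩ y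

theorem opMul_adjoint_closure_isFormalAdjoint [CompleteSpace H] {A : H →ₗ.[ℝ] K}
    (hd : Dense (A.domain : Set H)) (hc : A.IsClosable) :
    (opMul A.adjoint A.closure).IsFormalAdjoint (opMul A.adjoint A.closure) := by
  intro x y
  rw [inner_opMul_adjoint_closure hd hc x ⟨y, (mem_prodDomain.1 y.2).choose⟩, real_inner_comm,
    ← inner_opMul_adjoint_closure hd hc y ⟨x, (mem_prodDomain.1 x.2).choose⟩, real_inner_comm]

theorem opMul_adjoint_closure_nonneg [CompleteSpace H] {A : H →ₗ.[ℝ] K}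
    (hd : Dense (A.domain : Set H)) (hc : A.IsClosable)
    (x : (opMul A.adjoint A.closure).domain) :
    0 ≤ ⟪opMul A.adjoint A.closure x, (x : H)⟫_ℝ := by
  rw [inner_opMul_adjoint_closure hd hc x ⟨x, (mem_prodDomain.1 x.2).choose⟩]
  exact real_inner_self_nonneg

theorem isSelfAdjoint_of_isFormalAdjoint_of_surjective [CompleteSpace H] {B : H →ₗ.[ℝ] H}
    (hs : B.IsFormalAdjoint B) (hsurj : ∀ z, ∃ x : B.domain, (x : H) + B x = z) :
    IsSelfAdjoint B := by
  have key : ∀ x : B.domain, ∀ y : B.domain, ⟪(x : H) + B x, (y : H)⟫_ℝ = ⟪(x : H), y + B y⟫_ℝ := by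
    intro x y
    rw [inner_add_left, inner_add_right, hs x y]
  have hd : Dense (B.domain : Set H) := by
    rw [Submodule.dense_iff_topologicalClosure_eq_top, Submodule.topologicalClosure_eq_top_iff,
      Submodule.eq_bot_iff]
    intro z hz
    obtain ⟨x, rfl⟩ := hsurj z
    -- With `x = y + B y`, symmetry moves `1 + B` across: `⟪x, x⟫ = ⟪x + B x, y⟫ = ⟪z, y⟫ = 0`.
    have hx : (x : H) = 0 := by
      obtain ⟨y, hy⟩ := hsurj x
      rw [← inner_self_eq_zero (𝕜 := ℝ)]
      nth_rw 2 [← hy]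
      rw [← key x y, real_inner_comm]
      exact (Submodule.mem_orthogonal _ _).1 hz y y.2
    have hx' : x = 0 := Subtype.ext hx
    simp [hx']
  rw [LinearPMap.isSelfAdjoint_def]
  refine le_antisymm ?_ (hs.le_adjoint hd)
  have hle := hs.le_adjoint hd
  have hfa := B.adjoint_isFormalAdjoint hd
  refine LinearPMap.le_of_le_graph ?_
  rintro ⟨a, b⟩ hab
  obtain ⟨y, hy1, hy2⟩ := (LinearPMap.mem_graph_iff _).1 hab
  simp only at hy1 hy2
  obtain ⟨u, hu⟩ := hsurj (a + b)
  -- The vector `a - u` is orthogonal to the range of `1 + B`, which contains `a - u` itself.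
  have hau : a = u := by
    rw [← sub_eq_zero, ← inner_self_eq_zero (𝕜 := ℝ)]
    obtain ⟨v, hv⟩ := hsurj (a - u)
    nth_rw 2 [← hv]
    rw [inner_sub_left, ← key u v, hu, inner_add_right, inner_add_left, ← hy1, ← hy2, hfa y v]
    ring
  refine (LinearPMap.mem_graph_iff _).2 ⟨u, hau.symm, ?_⟩
  rw [hau] at hu
  exact add_left_cancel hu

theorem isSelfAdjoint_opMul_adjoint_closure [CompleteSpace H] [CompleteSpace K] {A : H →ₗ.[ℝ] K}
    (hd : Dense (A.domain : Set H)) (hc : A.IsClosable) :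
    IsSelfAdjoint (opMul A.adjoint A.closure) :=
  isSelfAdjoint_of_isFormalAdjoint_of_surjective (opMul_adjoint_closure_isFormalAdjoint hd hc)
    (exists_add_adjoint_closure_eq hd hc)

/-- Passing to adjoints reverses inclusions: `N ≤ N* ≤ A* = A`. -/
theorem eq_of_isSelfAdjoint_of_le [CompleteSpace H] {A N : H →ₗ.[ℝ] H} (hA : IsSelfAdjoint A)
    (hle : A ≤ N) (hN : N.IsFormalAdjoint N) : A = N := by
  refine LinearPMap.eq_of_le_of_domain_eq hle (le_antisymm hle.1 fun x hx => ?_)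
  rw [← (LinearPMap.isSelfAdjoint_def.1 hA)]
  refine A.mem_adjoint_domain_of_exists _ ⟨N ⟨x, hx⟩, fun y => ?_⟩
  rw [hle.2 (x := y) (y := ⟨y, hle.1 y.2⟩) rfl]
  exact hN ⟨x, hx⟩ ⟨y, hle.1 y.2⟩

/-- Positivity gives `‖u‖ ≤ ‖u + B u‖`. Hence, if `u n + S (u n)` tends to `a + B a`, then `u n`
tends to `a`, and by subtraction `S (u n)` tends to `B a`. -/
theorem graph_le_closure_of_dense {S B : H →ₗ.[ℝ] H} (hle : S ≤ B)
    (hpos : ∀ x : B.domain, 0 ≤ ⟪B x, (x : H)⟫_ℝ)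
    (hdense : Dense (Set.range fun x : S.domain => (x : H) + S x)) :
    (B.graph : Set (H × H)) ⊆ closure S.graph := by
  rintro ⟨a, b⟩ hab
  obtain ⟨x, hx1, hx2⟩ := (LinearPMap.mem_graph_iff _).1 hab
  simp only at hx1 hx2
  have hbound : ∀ u : B.domain, ‖(u : H)‖ ≤ ‖(u : H) + B u‖ := by
    intro u
    refine le_of_sq_le_sq ?_ (norm_nonneg _)
    rw [norm_add_sq_real, real_inner_comm]
    nlinarith [hpos u, sq_nonneg ‖B u‖]
  obtain ⟨w, hw, hlim⟩ := mem_closure_iff_seq_limit.1 (hdense (a + b))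
  choose u hu using hw
  simp only at hu
  have hub : ∀ n, ‖(u n : H) - a‖ ≤ ‖w n - (a + b)‖ := by
    intro n
    have h := hbound (⟨u n, hle.1 (u n).2⟩ - x)
    have e1 : w n - (a + b) = ((⟨u n, hle.1 (u n).2⟩ - x : B.domain) : H)
        + B (⟨u n, hle.1 (u n).2⟩ - x) := by
      rw [LinearPMap.map_sub, ← hle.2 (x := u n) (y := ⟨u n, hle.1 (u n).2⟩) rfl, hx2, ← hu n,
        ← hx1]
      simp only [Submodule.coe_sub]
      abel
    rw [e1, ← hx1]
    exact h
  have h1 : Filter.Tendsto (fun n => (u n : H)) Filter.atTop (nhds a) := by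
    rw [tendsto_iff_norm_sub_tendsto_zero] at hlim ⊢
    exact squeeze_zero (fun _ => norm_nonneg _) hub hlim
  have h2 : Filter.Tendsto (fun n => S (u n)) Filter.atTop (nhds b) := by
    have := hlim.sub h1
    simp only [add_sub_cancel_left] at this
    refine this.congr fun n => ?_
    rw [← hu n, add_sub_cancel_left]
  exact mem_closure_of_tendsto (h1.prodMk_nhds h2) (Filter.Eventually.of_forall fun n =>
    S.mem_graph (u n))

theorem closure_eq_of_dense {S B : H →ₗ.[ℝ] H} (hle : S ≤ B) (hB : B.IsClosed)
    (hpos : ∀ x : B.domain, 0 ≤ ⟪B x, (x : H)⟫_ℝ)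
    (hdense : Dense (Set.range fun x : S.domain => (x : H) + S x)) :
    S.IsClosable ∧ S.closure = B := by
  have hS : S.IsClosable := hB.isClosable.leIsClosable hle
  refine ⟨hS, LinearPMap.eq_of_eq_graph ?_⟩
  rw [← hS.graph_closure_eq_closure_graph]
  refine le_antisymm ?_ (graph_le_closure_of_dense hle hpos hdense)
  exact Submodule.topologicalClosure_minimal _ (LinearPMap.le_graph_of_le hle) hB

theorem opSeries_isFormalAdjoint {ι : Type*} {N : ι → H →ₗ.[ℝ] H}
    (hN : ∀ i, (N i).IsFormalAdjoint (N i)) :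
    (opSeries N).IsFormalAdjoint (opSeries N) := by
  intro x y
  have hx := opSeries_hasSum N x x.2.choose
  have hy := opSeries_hasSum N y y.2.choose
  have h1 := hx.mapL (innerSL ℝ (y : H))
  have h2 := hy.mapL (innerSL ℝ (x : H))
  rw [real_inner_comm]
  refine h1.unique ?_
  convert h2 using 1
  · ext i
    simp only [innerSL_apply_apply]
    rw [real_inner_comm]
    exact hN i ⟨x, _⟩ ⟨y, _⟩
  · rfl

/-- The bound on partial sums is uniform in the finite set. Along a core sequence every `N i (u n)`
is therefore Cauchy, closedness puts the limit in `dom (N i)`, and the uniform estimate allows the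
limit in `n` to be exchanged with the sum over `i`. -/
theorem le_opSeries {ι : Type*} [CompleteSpace H] {N : ι → H →ₗ.[ℝ] H} {S B : H →ₗ.[ℝ] H}
    (hN : ∀ i, (N i).IsClosed) (hcore : (B.graph : Set (H × H)) ⊆ closure S.graph)
    (hdom : ∀ i, S.domain ≤ (N i).domain)
    (hbound : ∀ (s : Finset ι) (x : S.domain), ‖∑ i ∈ s, N i ⟨x, hdom i x.2⟩‖ ≤ ‖S x‖)
    (hsum : ∀ x : S.domain, HasSum (fun i => N i ⟨x, hdom i x.2⟩) (S x)) :
    B ≤ opSeries N := by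
  classical
  refine LinearPMap.le_of_le_graph ?_
  rintro ⟨a, b⟩ hab
  obtain ⟨w, hw, hlim⟩ := mem_closure_iff_seq_limit.1 (hcore hab)
  have hw' : ∀ n, ∃ u : S.domain, (u : H) = (w n).1 ∧ S u = (w n).2 := fun n =>
    (LinearPMap.mem_graph_iff _).1 (hw n)
  choose u hu1 hu2 using hw'
  have ha : Filter.Tendsto (fun n => (u n : H)) Filter.atTop (nhds a) := by
    simp only [hu1]
    exact (continuous_fst.tendsto _).comp hlim
  have hb : Filter.Tendsto (fun n => S (u n)) Filter.atTop (nhds b) := by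
    simp only [hu2]
    exact (continuous_snd.tendsto _).comp hlim
  have hdiff : ∀ (s : Finset ι) (m n : ℕ),
      ‖∑ i ∈ s, N i ⟨u m, hdom i (u m).2⟩ - ∑ i ∈ s, N i ⟨u n, hdom i (u n).2⟩‖
        ≤ ‖S (u m) - S (u n)‖ := by
    intro s m n
    rw [← LinearPMap.map_sub, ← Finset.sum_sub_distrib]
    refine le_trans (le_of_eq ?_) (hbound s (u m - u n))
    congr 1
    refine Finset.sum_congr rfl fun i _ => ?_
    rw [← LinearPMap.map_sub]
    rfl
  have hcau : ∀ i, ∃ g,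
      Filter.Tendsto (fun n => N i ⟨u n, hdom i (u n).2⟩) Filter.atTop (nhds g) := by
    intro i
    refine cauchySeq_tendsto_of_complete ?_
    have hc := hb.cauchySeq
    rw [Metric.cauchySeq_iff] at hc ⊢
    intro ε hε
    obtain ⟨M, hM⟩ := hc ε hε
    refine ⟨M, fun m hm n hn => lt_of_le_of_lt ?_ (hM m hm n hn)⟩
    rw [dist_eq_norm, dist_eq_norm]
    simpa using hdiff {i} m n
  choose g hg using hcau
  have hmem : ∀ i, (a, g i) ∈ (N i).graph := fun i =>
    (hN i).mem_of_tendsto (ha.prodMk_nhds (hg i)) (Filter.Eventually.of_forall fun n =>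
      (N i).mem_graph ⟨u n, hdom i (u n).2⟩)
  have hd : ∀ i, a ∈ (N i).domain := fun i => LinearPMap.mem_domain_of_mem_graph (hmem i)
  have hval : ∀ i, N i ⟨a, hd i⟩ = g i := fun i =>
    (N i).mem_graph_snd_inj ((N i).mem_graph ⟨a, hd i⟩) (hmem i) rfl
  have hlimdiff : ∀ (s : Finset ι) (n : ℕ),
      ‖∑ i ∈ s, g i - ∑ i ∈ s, N i ⟨u n, hdom i (u n).2⟩‖ ≤ ‖b - S (u n)‖ := by
    intro s n
    have h1 : Filter.Tendsto (fun m => ∑ i ∈ s, N i ⟨u m, hdom i (u m).2⟩) Filter.atTop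
        (nhds (∑ i ∈ s, g i)) := tendsto_finsetSum s fun i _ => hg i
    exact le_of_tendsto_of_tendsto' (h1.sub_const _).norm (hb.sub_const _).norm
      fun m => hdiff s m n
  have hgs : HasSum g b := by
    rw [HasSum, SummationFilter.unconditional_filter, Metric.tendsto_atTop]
    intro ε hε
    obtain ⟨n, hn⟩ := (Metric.tendsto_atTop.1 hb (ε / 3) (by positivity))
    have hn := hn n le_rfl
    obtain ⟨s, hs⟩ := Metric.tendsto_atTop.1 (hsum (u n)) (ε / 3) (by positivity)
    refine ⟨s, fun t ht => ?_⟩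
    have h1 := hs t ht
    have h2 := hlimdiff t n
    rw [← dist_eq_norm, ← dist_eq_norm, dist_comm b] at h2
    calc dist (∑ i ∈ t, g i) b
        ≤ dist (∑ i ∈ t, g i) (∑ i ∈ t, N i ⟨u n, hdom i (u n).2⟩)
          + dist (∑ i ∈ t, N i ⟨u n, hdom i (u n).2⟩) (S (u n)) + dist (S (u n)) b :=
        dist_triangle4 _ _ _ _
      _ < ε := by linarith
  have hmemdom : a ∈ (opSeries N).domain := by
    refine ⟨hd, ?_⟩
    simp only [hval]
    exact hgs.summable
  refine (LinearPMap.mem_graph_iff _).2 ⟨⟨a, hmemdom⟩, rfl, ?_⟩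
  have h := opSeries_hasSum N ⟨a, hmemdom⟩ hd
  simp only [hval] at h
  exact h.unique hgs

end OperatorTheory

/-! ### Commutation relations and the number operator on formal polynomials. -/

section Algebra

open MvPolynomial

variable {L : Type*} [NormedAddCommGroup L] [InnerProductSpace ℝ L]

/-- The derivation of `ℝ[X_h : h ∈ L]` with `X_h ↦ ⟪h, k⟫`. -/
noncomputable def dirDeriv (k : L) :
    Derivation ℝ (MvPolynomial L ℝ) (MvPolynomial L ℝ) :=
  mkDerivation ℝ fun h => C ⟪h, k⟫_ℝ

@[simp]
theorem dirDeriv_X (k h : L) : dirDeriv k (X h) = C ⟪h, k⟫_ℝ := mkDerivation_X _ _ _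

theorem dirDeriv_comm (j k : L) (p : MvPolynomial L ℝ) :
    dirDeriv j (dirDeriv k p) = dirDeriv k (dirDeriv j p) := by
  have h : ⁅dirDeriv j, dirDeriv k⁆ = 0 := derivation_ext fun i => by
    simp [Derivation.commutator_apply]
  have := congrArg (fun D => D p) h
  simpa [Derivation.commutator_apply, sub_eq_zero] using this

/-- The formal adjoint `p ↦ X_k p - dirDeriv k p` of `dirDeriv k`. -/
noncomputable def creation (k : L) : MvPolynomial L ℝ →ₗ[ℝ] MvPolynomial L ℝ :=
  LinearMap.mulLeft ℝ (X k) - (dirDeriv k : MvPolynomial L ℝ →ₗ[ℝ] MvPolynomial L ℝ)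

theorem creation_apply (k : L) (p : MvPolynomial L ℝ) :
    creation k p = X k * p - dirDeriv k p := rfl

/-- The canonical commutation relation. -/
theorem dirDeriv_creation (j k : L) (p : MvPolynomial L ℝ) :
    dirDeriv j (creation k p) = ⟪k, j⟫_ℝ • p + creation k (dirDeriv j p) := by
  rw [creation_apply, creation_apply, map_sub, Derivation.leibniz, dirDeriv_X, dirDeriv_comm j k,
    MvPolynomial.smul_eq_C_mul]
  simp only [smul_eq_mul]
  ring

theorem dirDeriv_rename {n : ℕ} (h : Fin n → L) (k : L) (q : MvPolynomial (Fin n) ℝ) :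
    dirDeriv k (rename h q) = ∑ j, ⟪h j, k⟫_ℝ • rename h (pderiv j q) := by
  induction q using MvPolynomial.induction_on with
  | C a => simp [MvPolynomial.derivation_C]
  | add p q hp hq => simp [hp, hq, smul_add, Finset.sum_add_distrib]
  | mul_X p i hp =>
    rw [map_mul, Derivation.leibniz, hp, rename_X, dirDeriv_X]
    simp only [Derivation.leibniz, pderiv_X, smul_eq_mul, map_add, map_mul, rename_X, smul_add,
      Finset.sum_add_distrib, Finset.mul_sum]
    congr 1
    · rw [Finset.sum_eq_single i]
      · simp [MvPolynomial.smul_eq_C_mul, mul_comm]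
      · intro b _ hb
        simp [Pi.single_eq_of_ne' hb]
      · simp
    · refine Finset.sum_congr rfl fun j _ => ?_
      rw [mul_smul_comm]

/-- On a monomial of degree `d` the Euler part acts as `d` and the second-order part lowers the
degree. The operator is thus triangular with diagonal entries `1 + d ≠ 0`, and strong induction on
the degree inverts it. -/
theorem exists_add_euler_sub {n : ℕ} (g : Fin n → Fin n → ℝ) (q : MvPolynomial (Fin n) ℝ) :
    ∃ q', q' + ∑ j, (X j * pderiv j q' - ∑ i, g i j • pderiv i (pderiv j q')) = q := by
  let T : MvPolynomial (Fin n) ℝ →ₗ[ℝ] MvPolynomial (Fin n) ℝ :=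
    LinearMap.id + ∑ j, (LinearMap.mulLeft ℝ (X j) ∘ₗ (pderiv j).toLinearMap -
      ∑ i, g i j • ((pderiv i).toLinearMap ∘ₗ (pderiv j).toLinearMap))
  have hT : ∀ p, T p = p + ∑ j, (X j * pderiv j p - ∑ i, g i j • pderiv i (pderiv j p)) := by
    intro p
    simp [T, LinearMap.sum_apply]
  suffices h : q ∈ LinearMap.range T by
    obtain ⟨q', hq'⟩ := h
    exact ⟨q', by rw [← hT, hq']⟩
  have hmon : ∀ (d : ℕ) (s : Fin n →₀ ℕ) (a : ℝ), s.degree = d →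
      monomial s a ∈ LinearMap.range T := by
    intro d
    induction d using Nat.strong_induction_on with
    | _ d ih =>
      intro s a hs
      have hdd : ∀ i j, pderiv i (pderiv j (monomial s a)) ∈ LinearMap.range T := by
        intro i j
        rw [pderiv_monomial, pderiv_monomial]
        -- Subtraction of exponents is truncated: the degree drops only if `s j ≠ 0`, and otherwise
        -- the coefficient vanishes.
        by_cases hj : s j = 0
        · simp [hj]
        refine ih _ ?_ _ _ rfl
        rw [← hs]
        have h1 : (s - Finsupp.single j 1).degree < s.degree := by
          have h2 : s - Finsupp.single j 1 + Finsupp.single j 1 = s :=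
            tsub_add_cancel_of_le (Finsupp.single_le_iff.2 (Nat.one_le_iff_ne_zero.2 hj))
          have h3 := congrArg Finsupp.degree h2
          simp only [map_add, Finsupp.degree_single] at h3
          omega
        exact lt_of_le_of_lt (Finsupp.degree_mono tsub_le_self) h1
      have hE := hT (monomial s a)
      simp only [X_mul_pderiv_monomial, Finset.sum_sub_distrib, ← Finset.sum_smul] at hE
      have hdeg : (∑ i, s i) = d := by rw [← hs, Finsupp.degree_eq_sum]
      rw [hdeg] at hE
      have hmem : ((1 : ℝ) + d) • monomial s a ∈ LinearMap.range T := by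
        have : ((1 : ℝ) + d) • monomial s a =
            T (monomial s a) + ∑ j, ∑ i, g i j • pderiv i (pderiv j (monomial s a)) := by
          rw [hE, add_smul, one_smul, Nat.cast_smul_eq_nsmul]
          abel
        rw [this]
        exact Submodule.add_mem _ ⟨_, rfl⟩ (Submodule.sum_mem _ fun j _ =>
          Submodule.sum_mem _ fun i _ => Submodule.smul_mem _ _ (hdd i j))
      exact (Submodule.smul_mem_iff _ (by positivity)).1 hmem
  induction q using MvPolynomial.induction_on' with
  | monomial s a => exact hmon _ s a rfl
  | add p q hp hq => exact Submodule.add_mem _ hp hq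

theorem creation_rename {n : ℕ} (h : Fin n → L) (j : Fin n) (q : MvPolynomial (Fin n) ℝ) :
    creation (h j) (rename h q) =
      rename h (X j * q - ∑ i, ⟪h i, h j⟫_ℝ • pderiv i q) := by
  rw [creation_apply, dirDeriv_rename]
  simp

theorem exists_add_number {n : ℕ} (h : Fin n → L) (q : MvPolynomial (Fin n) ℝ) :
    ∃ q', rename h q' + ∑ j, creation (h j) (rename h (pderiv j q')) = rename h q := by
  obtain ⟨q', hq'⟩ := exists_add_euler_sub (fun i j => ⟪h i, h j⟫_ℝ) q
  refine ⟨q', ?_⟩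
  rw [← hq', map_add, map_sum]
  simp only [creation_rename]

/-- Polynomials split into powers of `X k` times polynomials in directions orthogonal to `k`. -/
theorem exists_orthogonal_splitting (k : L) (hk : k ≠ 0) :
    ∃ ψ : MvPolynomial L ℝ →ₐ[ℝ] MvPolynomial L ℝ,
      (∀ h, ψ (X h) = C (⟪h, k⟫_ℝ / ‖k‖ ^ 2) * X k + X (h - (⟪h, k⟫_ℝ / ‖k‖ ^ 2) • k)) ∧
      (∀ p, dirDeriv k (ψ p) = ψ (dirDeriv k p)) ∧
      ∀ p, ψ p ∈ Submodule.span ℝ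
        {P | ∃ (m : ℕ) (r : MvPolynomial L ℝ), r ∈ supported ℝ {h : L | ⟪h, k⟫_ℝ = 0} ∧
          P = X k ^ m * r} := by
  have hk2 : ‖k‖ ^ 2 ≠ 0 := by simpa using hk
  have horth : ∀ h : L, ⟪h - (⟪h, k⟫_ℝ / ‖k‖ ^ 2) • k, k⟫_ℝ = 0 := by
    intro h
    rw [inner_sub_left, inner_smul_left, real_inner_self_eq_norm_sq]
    simp
    field_simp
    simp
  -- The substitution decomposes each index `h` into its component along `k` and its component
  -- orthogonal to `k`.
  refine ⟨aeval fun h => C (⟪h, k⟫_ℝ / ‖k‖ ^ 2) * X k + X (h - (⟪h, k⟫_ℝ / ‖k‖ ^ 2) • k),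
    fun h => aeval_X _ _, fun p => ?_, fun p => ?_⟩
  · induction p using MvPolynomial.induction_on with
    | C a => simp [MvPolynomial.derivation_C]
    | add p q hp hq => simp only [map_add, hp, hq]
    | mul_X p h hp =>
      rw [map_mul, Derivation.leibniz, hp, Derivation.leibniz, map_add, aeval_X, dirDeriv_X,
        map_add, Derivation.leibniz, MvPolynomial.derivation_C, dirDeriv_X, dirDeriv_X, horth,
        real_inner_self_eq_norm_sq]
      simp only [smul_eq_mul, map_mul, mul_zero, add_zero, map_zero, aeval_X, algHom_C,
        MvPolynomial.algebraMap_eq]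
      rw [← C_mul, div_mul_cancel₀ _ hk2]
  · induction p using MvPolynomial.induction_on with
    | C a =>
      refine Submodule.subset_span ⟨0, C a, ?_, by simp⟩
      exact Subalgebra.algebraMap_mem _ a
    | add p q hp hq =>
      rw [map_add]
      exact Submodule.add_mem _ hp hq
    | mul_X p h hp =>
      rw [map_mul, aeval_X]
      refine Submodule.span_induction (p := fun P _ => P *
        (C (⟪h, k⟫_ℝ / ‖k‖ ^ 2) * X k + X (h - (⟪h, k⟫_ℝ / ‖k‖ ^ 2) • k)) ∈ _) ?_ ?_ ?_ ?_ hp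
      · rintro _ ⟨m, r, hr, rfl⟩
        rw [mul_add]
        refine Submodule.add_mem _ ?_ (Submodule.subset_span ⟨m, r * X _,
          Subalgebra.mul_mem _ hr (X_mem_supported.2 (horth h)), by ring⟩)
        rw [← MvPolynomial.smul_eq_C_mul, mul_smul_comm]
        exact Submodule.smul_mem _ _ (Submodule.subset_span ⟨m + 1, r, hr, by ring⟩)
      · simp
      · intro x y _ _ hx hy
        rw [add_mul]
        exact Submodule.add_mem _ hx hy
      · intro a x _ hx
        rw [smul_mul_assoc]
        exact Submodule.smul_mem _ _ hx

theorem dirDeriv_eq_zero_of_mem_supported (k : L) {r : MvPolynomial L ℝ}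
    (hr : r ∈ supported ℝ {h : L | ⟪h, k⟫_ℝ = 0}) : dirDeriv k r = 0 :=
  derivation_eqOn_supported (D₁ := dirDeriv k) (D₂ := 0)
    (fun h hh => by
      have hh' : ⟪h, k⟫_ℝ = 0 := hh
      simp [hh']) hr

end Algebra

/-! ### Moments of the one-dimensional Gaussian. -/

section Moments

open scoped NNReal

theorem hasDerivAt_gaussianPDFReal_zero (v : ℝ≥0) (x : ℝ) :
    HasDerivAt (gaussianPDFReal 0 v) (-(x / v) * gaussianPDFReal 0 v x) x := by
  have h1 : HasDerivAt (fun y : ℝ => -(y - 0) ^ 2 / (2 * v)) (-(2 * x) / (2 * v)) x := by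
    have := (((hasDerivAt_id x).sub_const 0).pow 2).neg.div_const (2 * (v : ℝ))
    refine this.congr_deriv ?_
    simp
  have h2 := h1.exp.const_mul (√(2 * Real.pi * v))⁻¹
  have e : gaussianPDFReal 0 v =
      fun y => (√(2 * Real.pi * v))⁻¹ * Real.exp (-(y - 0) ^ 2 / (2 * v)) := by
    ext y
    rw [gaussianPDFReal]
  rw [e]
  refine h2.congr_deriv ?_
  have : -(2 * x) / (2 * (v : ℝ)) = -(x / v) := by
    rw [neg_div, mul_div_mul_left _ _ two_ne_zero]
  rw [this]
  ring

theorem integrable_pow_gaussianReal (v : ℝ≥0) (m : ℕ) :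
    Integrable (fun x : ℝ => x ^ m) (gaussianReal 0 v) := by
  have h := (memLp_id_gaussianReal' (μ := 0) (v := v) m (by simp))
  rcases Nat.eq_zero_or_pos m with rfl | hm
  · simp
  · have := h.integrable_norm_pow (by omega)
    refine (integrable_norm_iff (by fun_prop)).1 ?_
    simpa using this

/-- Integration by parts, using that the density `ρ` satisfies `ρ' = -(x / v) ρ`. The truncated
exponent at `m = 0` is harmless because of the factor `m`; the Dirac case `v = 0` is treated apart.
-/
theorem integral_pow_succ_gaussianReal (v : ℝ≥0) (m : ℕ) :
    ∫ x, x ^ (m + 1) ∂gaussianReal 0 v = v * (m * ∫ x, x ^ (m - 1) ∂gaussianReal 0 v) := by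
  by_cases hv : v = 0
  · subst hv
    simp
  have hv' : (v : ℝ) ≠ 0 := by exact_mod_cast hv
  have hint : ∀ n : ℕ, Integrable (fun x : ℝ => gaussianPDFReal 0 v x * x ^ n) := by
    intro n
    have := integrable_pow_gaussianReal v n
    rw [gaussianReal_of_var_ne_zero _ hv, integrable_withDensity_iff_integrable_smul'
      (measurable_gaussianPDF _ _)
      (Filter.Eventually.of_forall fun _ => gaussianPDF_lt_top)] at this
    simpa using this
  have key := integral_mul_deriv_eq_deriv_mul_of_integrable (u := fun x : ℝ => x ^ m)
    (u' := fun x => m * x ^ (m - 1)) (v := gaussianPDFReal 0 v)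
    (v' := fun x => -(x / v) * gaussianPDFReal 0 v x)
    (fun x _ => hasDerivAt_pow m x) (fun x _ => hasDerivAt_gaussianPDFReal_zero v x)
    (by
      refine ((hint (m + 1)).const_mul (-(v : ℝ)⁻¹)).congr (Filter.Eventually.of_forall fun x => ?_)
      simp only [Pi.mul_apply]
      ring)
    (by
      refine ((hint (m - 1)).const_mul (m : ℝ)).congr (Filter.Eventually.of_forall fun x => ?_)
      simp only [Pi.mul_apply]
      ring)
    (by
      refine (hint m).congr (Filter.Eventually.of_forall fun x => ?_)
      simp only [Pi.mul_apply]
      ring)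
  rw [integral_gaussianReal_eq_integral_smul hv, integral_gaussianReal_eq_integral_smul hv]
  have e1 : ∫ x : ℝ, x ^ m * (-(x / v) * gaussianPDFReal 0 v x) =
      -(v : ℝ)⁻¹ * ∫ x : ℝ, gaussianPDFReal 0 v x • x ^ (m + 1) := by
    rw [← integral_const_mul]
    refine integral_congr_ae (Filter.Eventually.of_forall fun x => ?_)
    simp only [smul_eq_mul]
    ring
  have e2 : ∫ x : ℝ, m * x ^ (m - 1) * gaussianPDFReal 0 v x =
      m * ∫ x : ℝ, gaussianPDFReal 0 v x • x ^ (m - 1) := by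
    rw [← integral_const_mul]
    refine integral_congr_ae (Filter.Eventually.of_forall fun x => ?_)
    simp only [smul_eq_mul]
    ring
  rw [e1, e2] at key
  field_simp at key
  linarith

end Moments

/-! ### Polynomials in the field and Gaussian integration by parts. -/

section Polynomials

open MvPolynomial

variable {L Ω : Type*} [NormedAddCommGroup L] [InnerProductSpace ℝ L] [MeasurableSpace Ω]
  {P : Measure Ω}

/-- The random variable obtained from a polynomial in the indeterminates `X_h`, `h ∈ L`, by
substituting `Φ h` for `X_h`. -/
noncomputable def polyEval (Φ : L →ₗ[ℝ] Lp ℝ 2 P) (p : MvPolynomial L ℝ) : Ω → ℝ :=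
  fun ω => eval (fun h => Φ h ω) p

theorem polyFun_eq_polyEval (Φ : L →ₗ[ℝ] Lp ℝ 2 P) {n : ℕ} (h : Fin n → L)
    (p : MvPolynomial (Fin n) ℝ) : polyFun Φ h p = polyEval Φ (rename h p) := by
  ext ω
  simp only [polyFun, polyEval, eval_rename]
  rfl

theorem IsGaussianField.memLp {Φ : L →ₗ[ℝ] Lp ℝ 2 P} (hΦ : IsGaussianField Φ) (h : L)
    {q : ENNReal} (hq : q ≠ ⊤) : MemLp (fun ω => Φ h ω) q P :=
  (hΦ.gaussian.hasGaussianLaw_eval h).memLp hq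

theorem memLp_polyEval {Φ : L →ₗ[ℝ] Lp ℝ 2 P} (hΦ : IsGaussianField Φ)
    (p : MvPolynomial L ℝ) {q : ENNReal} (hq : q ≠ ⊤) : MemLp (polyEval Φ p) q P := by
  have := hΦ.gaussian.isProbabilityMeasure
  induction p using MvPolynomial.induction_on generalizing q with
  | C a =>
    have : polyEval Φ (C a) = fun _ => a := by ext; simp [polyEval]
    rw [this]
    exact memLp_const a
  | add p r hp hr =>
    have : polyEval Φ (p + r) = polyEval Φ p + polyEval Φ r := by ext; simp [polyEval]
    rw [this]
    exact (hp hq).add (hr hq)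
  | mul_X p h hp =>
    have : polyEval Φ (p * X h) = polyEval Φ p * fun ω => Φ h ω := by ext; simp [polyEval]
    rw [this]
    -- Hölder's inequality doubles the exponent, which is why the induction generalizes over `q`.
    have h2 : (2 : ENNReal) * q ≠ ⊤ := ENNReal.mul_ne_top (by simp) hq
    have : ENNReal.HolderTriple (2 * q) (2 * q) q := ⟨by
      rw [ENNReal.mul_inv (by simp) (by simp), ← add_mul, ENNReal.inv_two_add_inv_two, one_mul]⟩
    exact (hΦ.memLp h h2).mul (hp h2)

theorem integrable_polyEval {Φ : L →ₗ[ℝ] Lp ℝ 2 P} (hΦ : IsGaussianField Φ)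
    (p : MvPolynomial L ℝ) : Integrable (polyEval Φ p) P :=
  memLp_one_iff_integrable.1 (memLp_polyEval hΦ p (by simp))

theorem IsGaussianField.map_eq {Φ : L →ₗ[ℝ] Lp ℝ 2 P} (hΦ : IsGaussianField Φ) (k : L) :
    P.map (fun ω => Φ k ω) = gaussianReal 0 (‖k‖₊ ^ 2) := by
  have := hΦ.gaussian.isProbabilityMeasure
  have h := hΦ.gaussian.hasGaussianLaw_eval k
  rw [h.map_eq_gaussianReal, hΦ.mean k,
    variance_of_integral_eq_zero h.aemeasurable (hΦ.mean k)]
  congr 1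
  have := hΦ.covariance k k
  simp only [← sq, real_inner_self_eq_norm_sq] at this
  rw [this]
  ext
  simp

theorem IsGaussianField.integral_pow_succ {Φ : L →ₗ[ℝ] Lp ℝ 2 P} (hΦ : IsGaussianField Φ)
    (k : L) (m : ℕ) :
    ∫ ω, (Φ k ω) ^ (m + 1) ∂P = ‖k‖ ^ 2 * (m * ∫ ω, (Φ k ω) ^ (m - 1) ∂P) := by
  have h := (hΦ.gaussian.hasGaussianLaw_eval k).aemeasurable
  have e : ∀ n : ℕ, ∫ ω, (Φ k ω) ^ n ∂P = ∫ x, x ^ n ∂gaussianReal 0 (‖k‖₊ ^ 2) := by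
    intro n
    rw [← hΦ.map_eq k, integral_map h (by fun_prop)]
  rw [e, e, integral_pow_succ_gaussianReal]
  simp

theorem measurable_eval_pi {σ : Type*} (p : MvPolynomial σ ℝ) :
    Measurable fun x : σ → ℝ => eval x p := by
  induction p using MvPolynomial.induction_on with
  | C a => simp
  | add p q hp hq =>
    simp only [map_add]
    exact hp.add hq
  | mul_X p i hp =>
    simp only [map_mul, eval_X]
    exact hp.mul (measurable_pi_apply i)

/-- Jointly Gaussian families with zero cross-covariance are independent; here the families are `Φ
k` and all `Φ h` with `h ⟂ k`. -/
theorem indepFun_of_mem_supported {Φ : L →ₗ[ℝ] Lp ℝ 2 P} (hΦ : IsGaussianField Φ) (k : L)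
    {r : MvPolynomial L ℝ} (hr : r ∈ supported ℝ {h : L | ⟪h, k⟫_ℝ = 0}) :
    IndepFun (fun ω => Φ k ω) (polyEval Φ r) P := by
  have := hΦ.gaussian.isProbabilityMeasure
  rw [supported_eq_range_rename] at hr
  obtain ⟨r', rfl⟩ := hr
  let X : Unit → Ω → ℝ := fun _ ω => Φ k ω
  let Y : {h : L | ⟪h, k⟫_ℝ = 0} → Ω → ℝ := fun h ω => Φ (h : L) ω
  have hXY : IsGaussianProcess (Sum.elim X Y) P := by
    have e : Sum.elim X Y = (fun (h : L) ω => Φ h ω) ∘ Sum.elim (fun _ : Unit => k)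
        (fun h : {h : L | ⟪h, k⟫_ℝ = 0} => (h : L)) := by
      funext s
      cases s <;> rfl
    rw [e]
    exact hΦ.gaussian.comp_right _
  have hind := hXY.indepFun_of_covariance_eq_zero
    (fun _ => hΦ.gaussian.aemeasurable k) (fun h => hΦ.gaussian.aemeasurable (h : L))
    (fun _ h => by
      rw [covariance_eq_sub (hΦ.memLp k (by simp)) (hΦ.memLp (h : L) (by simp))]
      have h1 := hΦ.covariance k h
      have h2 : ⟪k, (h : L)⟫_ℝ = 0 := by rw [real_inner_comm]; exact h.2
      simp only [Pi.mul_apply, hΦ.mean, h1, h2]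
      simp)
  have hφ : Measurable fun x : Unit → ℝ => x () := measurable_pi_apply ()
  have e : polyEval Φ ((rename Subtype.val).toRingHom r') =
      (fun x => eval x r') ∘ fun ω t => Y t ω := by
    ext ω
    exact eval_rename _ _ _
  rw [e]
  exact hind.comp hφ (measurable_eval_pi r')

/-- Independence factors out `r`, which `dirDeriv k` kills, and leaves the moment recursion for `Φ
k`. -/
theorem integral_mul_polyEval_of_mem_supported {Φ : L →ₗ[ℝ] Lp ℝ 2 P} (hΦ : IsGaussianField Φ)
    (k : L) (m : ℕ) {r : MvPolynomial L ℝ} (hr : r ∈ supported ℝ {h : L | ⟪h, k⟫_ℝ = 0}) :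
    ∫ ω, Φ k ω * polyEval Φ (X k ^ m * r) ω ∂P =
      ∫ ω, polyEval Φ (dirDeriv k (X k ^ m * r)) ω ∂P := by
  have hind := indepFun_of_mem_supported hΦ k hr
  have hk := hΦ.gaussian.aemeasurable k
  have hfac : ∀ n : ℕ, ∫ ω, (Φ k ω) ^ n * polyEval Φ r ω ∂P =
      (∫ ω, (Φ k ω) ^ n ∂P) * ∫ ω, polyEval Φ r ω ∂P := by
    intro n
    exact (hind.comp (φ := fun x : ℝ => x ^ n) (by fun_prop)
      measurable_id).integral_fun_mul_eq_mul_integral (hk.pow_const n).aestronglyMeasurable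
      (integrable_polyEval hΦ r).1
  have h1 : ∀ ω, Φ k ω * polyEval Φ (X k ^ m * r) ω = (Φ k ω) ^ (m + 1) * polyEval Φ r ω := by
    intro ω
    simp only [polyEval, map_mul, map_pow, eval_X]
    ring
  have h2 : ∀ ω, polyEval Φ (dirDeriv k (X k ^ m * r)) ω =
      (‖k‖ ^ 2 * m) * ((Φ k ω) ^ (m - 1) * polyEval Φ r ω) := by
    intro ω
    rw [Derivation.leibniz, dirDeriv_eq_zero_of_mem_supported k hr, Derivation.leibniz_pow,
      dirDeriv_X, real_inner_self_eq_norm_sq]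
    simp only [polyEval, smul_eq_mul, nsmul_eq_mul, mul_zero, zero_add, map_mul, map_pow, eval_X,
      eval_C, map_natCast]
    ring
  simp only [h1, h2]
  rw [hfac, integral_const_mul, hfac, hΦ.integral_pow_succ k m]
  ring

theorem field_eq_add_ae {Φ : L →ₗ[ℝ] Lp ℝ 2 P} (a : ℝ) (h k : L) :
    ∀ᵐ ω ∂P, Φ h ω = a * Φ k ω + Φ (h - a • k) ω := by
  rw [map_sub, map_smul]
  filter_upwards [Lp.coeFn_sub (Φ h) (a • Φ k), Lp.coeFn_smul a (Φ k)] with ω h1 h2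
  rw [h1, Pi.sub_apply, h2, Pi.smul_apply, smul_eq_mul]
  ring

/-- Gaussian integration by parts. -/
theorem integral_mul_polyEval {Φ : L →ₗ[ℝ] Lp ℝ 2 P} (hΦ : IsGaussianField Φ)
    (k : L) (p : MvPolynomial L ℝ) :
    ∫ ω, Φ k ω * polyEval Φ p ω ∂P = ∫ ω, polyEval Φ (dirDeriv k p) ω ∂P := by
  -- The orthogonal splitting divides by `‖k‖ ^ 2`.
  by_cases hk : k = 0
  · subst hk
    have h0 : ∀ᵐ ω ∂P, Φ 0 ω = 0 := by
      rw [map_zero]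
      exact Lp.coeFn_zero ℝ 2 P
    have hd : dirDeriv (0 : L) p = 0 := by
      have : dirDeriv (0 : L) = 0 := derivation_ext fun i => by simp
      simp [this]
    rw [hd, integral_congr_ae (g := fun _ => (0 : ℝ))]
    · simp [polyEval]
    · filter_upwards [h0] with ω hω
      rw [hω, zero_mul]
  obtain ⟨ψ, hψX, hψD, hψs⟩ := exists_orthogonal_splitting k hk
  -- Although `ψ p` and `p` differ as polynomials, linearity of `Φ` makes them the same random
  -- variable almost surely.
  have hψe : ∀ p, polyEval Φ (ψ p) =ᵐ[P] polyEval Φ p := by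
    intro p
    induction p using MvPolynomial.induction_on with
    | C a =>
      have : ψ (C a) = C a := ψ.commutes a
      rw [this]
    | add p q hp hq =>
      filter_upwards [hp, hq] with ω h1 h2
      simp only [polyEval, map_add] at h1 h2 ⊢
      rw [h1, h2]
    | mul_X p h hp =>
      filter_upwards [hp, field_eq_add_ae (Φ := Φ) (⟪h, k⟫_ℝ / ‖k‖ ^ 2) h k]
        with ω h1 h2
      simp only [polyEval] at h1 ⊢
      rw [map_mul, map_mul, h1, hψX, map_mul, eval_X, h2]
      simp
  have hgood : ∀ q ∈ Submodule.span ℝ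
      {P | ∃ (m : ℕ) (r : MvPolynomial L ℝ), r ∈ supported ℝ {h : L | ⟪h, k⟫_ℝ = 0} ∧
          P = X k ^ m * r}, ∫ ω, Φ k ω * polyEval Φ q ω ∂P =
            ∫ ω, polyEval Φ (dirDeriv k q) ω ∂P := by
    have hXk : ∀ q ω, Φ k ω * polyEval Φ q ω = polyEval Φ (X k * q) ω := by
      intro q ω
      simp [polyEval]
    intro q hq
    induction hq using Submodule.span_induction with
    | mem x hx =>
      obtain ⟨m, r, hr, rfl⟩ := hx
      exact integral_mul_polyEval_of_mem_supported hΦ k m hr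
    | zero => simp [polyEval]
    | add x y _ _ hx hy =>
      simp only [hXk] at hx hy ⊢
      have e1 : ∀ a b ω, polyEval Φ (a + b) ω = polyEval Φ a ω + polyEval Φ b ω := by
        simp [polyEval]
      simp only [mul_add, map_add, e1]
      rw [integral_add (integrable_polyEval hΦ _) (integrable_polyEval hΦ _), hx, hy,
        integral_add (integrable_polyEval hΦ _) (integrable_polyEval hΦ _)]
    | smul a x _ hx =>
      have e1 : ∀ b ω, polyEval Φ (a • b) ω = a * polyEval Φ b ω := by
        simp [polyEval, MvPolynomial.smul_eval]
      simp only [Derivation.map_smul, e1, integral_const_mul, ← hx]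
      rw [← integral_const_mul]
      refine integral_congr_ae (Filter.Eventually.of_forall fun ω => ?_)
      simp only
      ring
  have h := hgood (ψ p) (hψs p)
  rw [hψD, integral_congr_ae (hψe (dirDeriv k p))] at h
  rw [← h]
  refine integral_congr_ae ?_
  filter_upwards [hψe p] with ω hω
  rw [hω]

end Polynomials

/-! ### A dominating bound for subseries of the exponential. -/

section PowerSeries

open Finset in
theorem sum_comp_pow_div_factorial_le_exp {φ : ℕ → ℕ} (hφ : Function.Injective φ) (n : ℕ) {x : ℝ}
    (hx : 0 ≤ x) : ∑ m ∈ range n, x ^ φ m / (φ m).factorial ≤ Real.exp x := by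
  rw [← sum_image (f := fun i => x ^ i / (i.factorial : ℝ)) hφ.injOn]
  refine le_trans (sum_le_sum_of_subset_of_nonneg (subset_range_sup_succ _) ?_)
    (Real.sum_le_exp_of_nonneg hx _)
  intros
  positivity

end PowerSeries

/-! ### Density of the polynomials in `L²`. -/

section Density

open MvPolynomial Filter
open scoped Topology

variable {L Ω : Type*} [NormedAddCommGroup L] [InnerProductSpace ℝ L] [MeasurableSpace Ω]
  {P : Measure Ω}

/-- The class in `L²` of a polynomial in the Gaussian field. -/
noncomputable def polyLp {Φ : L →ₗ[ℝ] Lp ℝ 2 P} (hΦ : IsGaussianField Φ) :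
    MvPolynomial L ℝ →ₗ[ℝ] Lp ℝ 2 P where
  toFun p := (memLp_polyEval hΦ p (by simp)).toLp
  map_add' p q := by
    rw [← MemLp.toLp_add]
    congr 1
    ext ω
    simp [polyEval]
  map_smul' c p := by
    rw [RingHom.id_apply, ← MemLp.toLp_const_smul]
    congr 1
    ext ω
    simp [polyEval, MvPolynomial.smul_eval]

variable {Φ : L →ₗ[ℝ] Lp ℝ 2 P}

theorem coeFn_polyLp (hΦ : IsGaussianField Φ) (p : MvPolynomial L ℝ) :
    polyLp hΦ p =ᵐ[P] polyEval Φ p :=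
  MemLp.coeFn_toLp (memLp_polyEval hΦ p (by simp))

theorem tendsto_polyLp (hΦ : IsGaussianField Φ) (p : ℕ → MvPolynomial L ℝ) {B g : Ω → ℝ}
    (hB : MemLp B 2 P) (hbound : ∀ n ω, |polyEval Φ (p n) ω| ≤ B ω)
    (hlim : ∀ ω, Tendsto (fun n => polyEval Φ (p n) ω) atTop (𝓝 (g ω)))
    (G : Lp ℝ 2 P) (hG : G =ᵐ[P] g) : Tendsto (fun n => polyLp hΦ (p n)) atTop (𝓝 G) := by
  rw [tendsto_iff_norm_sub_tendsto_zero]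
  have hsq : Tendsto (fun n => ‖polyLp hΦ (p n) - G‖ ^ 2) atTop (𝓝 0) := by
    have e : ∀ n, ‖polyLp hΦ (p n) - G‖ ^ 2 = ∫ ω, (polyEval Φ (p n) ω - g ω) ^ 2 ∂P := by
      intro n
      rw [← real_inner_self_eq_norm_sq, L2.inner_def]
      refine integral_congr_ae ?_
      filter_upwards [Lp.coeFn_sub (polyLp hΦ (p n)) G, coeFn_polyLp hΦ (p n), hG] with ω h1 h2 h3
      rw [h1, Pi.sub_apply, h2, h3, real_inner_self_eq_norm_sq, Real.norm_eq_abs, sq_abs]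
    have hg : AEStronglyMeasurable g P := G.1.aestronglyMeasurable.congr hG
    have hgB : ∀ ω, |g ω| ≤ B ω := fun ω =>
      le_of_tendsto (hlim ω).abs (Eventually.of_forall fun n => hbound n ω)
    simp only [e]
    have h0 : (0 : ℝ) = ∫ _, (0 : ℝ) ∂P := by simp
    rw [h0]
    refine tendsto_integral_of_dominated_convergence (fun ω => (2 * B ω) ^ 2) ?_ ?_ ?_ ?_
    · exact fun n => (((memLp_polyEval hΦ (p n) (q := 2) (by simp)).1).sub hg).pow 2
    · exact (hB.const_mul 2).integrable_sq
    · intro n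
      refine Eventually.of_forall fun ω => ?_
      rw [Real.norm_eq_abs, abs_of_nonneg (sq_nonneg _)]
      refine sq_le_sq' ?_ ?_
      · have := abs_le.1 (hbound n ω)
        have := abs_le.1 (hgB ω)
        linarith
      · have := abs_le.1 (hbound n ω)
        have := abs_le.1 (hgB ω)
        linarith
    · refine Eventually.of_forall fun ω => ?_
      have := ((hlim ω).sub_const (g ω)).pow 2
      simpa using this
  have := hsq.sqrt
  simpa [Real.sqrt_sq] using this

theorem IsGaussianField.memLp_exp (hΦ : IsGaussianField Φ) (h : L) (a : ℝ) :
    MemLp (fun ω => Real.exp (a * |Φ h ω|)) 2 P := by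
  have hm := (hΦ.gaussian.aemeasurable h)
  have hi : ∀ t : ℝ, Integrable (fun ω => Real.exp (t * Φ h ω)) P := by
    intro t
    have := integrable_exp_mul_gaussianReal (μ := 0) (v := ‖h‖₊ ^ 2) t
    rw [← hΦ.map_eq h, integrable_map_measure (by fun_prop) hm] at this
    exact this
  rw [memLp_two_iff_integrable_sq (by fun_prop)]
  refine ((hi (2 * a)).add (hi (-(2 * a)))).mono' (by fun_prop) (Eventually.of_forall fun ω => ?_)
  rw [Real.norm_eq_abs, abs_of_nonneg (sq_nonneg _), ← Real.exp_nat_mul, Pi.add_apply]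
  rcases abs_cases (Φ h ω) with ⟨h1, _⟩ | ⟨h1, _⟩
  · rw [h1]
    refine le_add_of_le_of_nonneg (le_of_eq ?_) (Real.exp_pos _).le
    congr 1
    push_cast
    ring
  · rw [h1]
    refine le_add_of_nonneg_of_le (Real.exp_pos _).le (le_of_eq ?_)
    congr 1
    push_cast
    ring

/-- A power series in `Φ h` whose coefficients are bounded by those of the exponential converges
in `L²`. -/
theorem tendsto_polyLp_powerSeries (hΦ : IsGaussianField Φ) (h : L) {φ : ℕ → ℕ}
    (hφ : Function.Injective φ) (c : ℕ → ℝ) (hc : ∀ m, |c m| ≤ 1 / (φ m).factorial) {g : ℝ → ℝ}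
    (hg : ∀ x, HasSum (fun m => c m * x ^ φ m) (g x))
    (G : Lp ℝ 2 P) (hG : G =ᵐ[P] fun ω => g (Φ h ω)) :
    Tendsto (fun n => polyLp hΦ (∑ m ∈ Finset.range n, C (c m) * X h ^ φ m)) atTop (𝓝 G) := by
  have he : ∀ n ω, polyEval Φ (∑ m ∈ Finset.range n, C (c m) * X h ^ φ m) ω =
      ∑ m ∈ Finset.range n, c m * (Φ h ω) ^ φ m := by
    intro n ω
    simp [polyEval]
  refine tendsto_polyLp hΦ _ (hΦ.memLp_exp h 1) ?_ ?_ G hG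
  · intro n ω
    rw [he, one_mul]
    refine (Finset.abs_sum_le_sum_abs _ _).trans (le_trans (Finset.sum_le_sum fun m _ => ?_)
      (sum_comp_pow_div_factorial_le_exp hφ n (abs_nonneg (Φ h ω))))
    rw [abs_mul, abs_pow, div_eq_mul_one_div, mul_comm]
    exact mul_le_mul_of_nonneg_left (hc m) (by positivity)
  · intro ω
    simp only [he]
    exact (hg _).tendsto_sum_nat

theorem inner_eq_zero_of_powerSeries (hΦ : IsGaussianField Φ) {f : Lp ℝ 2 P}
    (hf : ∀ p, ⟪f, polyLp hΦ p⟫_ℝ = 0) (h : L) {φ : ℕ → ℕ}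
    (hφ : Function.Injective φ) (c : ℕ → ℝ) (hc : ∀ m, |c m| ≤ 1 / (φ m).factorial) {g : ℝ → ℝ}
    (hg : ∀ x, HasSum (fun m => c m * x ^ φ m) (g x)) (hgL : MemLp (fun ω => g (Φ h ω)) 2 P) :
    ∫ ω, f ω * g (Φ h ω) ∂P = 0 := by
  have ht := tendsto_polyLp_powerSeries hΦ h hφ c hc hg hgL.toLp hgL.coeFn_toLp
  have h1 := (tendsto_const_nhds (x := f)).inner (𝕜 := ℝ) ht
  simp only [hf] at h1
  have h2 := tendsto_nhds_unique h1 tendsto_const_nhds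
  rw [L2.inner_def] at h2
  rw [← h2]
  refine integral_congr_ae ?_
  filter_upwards [hgL.coeFn_toLp] with ω hω
  rw [hω]
  simp [mul_comm]

theorem integral_mul_cos_sin_eq_zero (hΦ : IsGaussianField Φ) {f : Lp ℝ 2 P}
    (hf : ∀ p, ⟪f, polyLp hΦ p⟫_ℝ = 0) (h : L) :
    ∫ ω, f ω * Real.cos (Φ h ω) ∂P = 0 ∧ ∫ ω, f ω * Real.sin (Φ h ω) ∂P = 0 := by
  have := hΦ.gaussian.isProbabilityMeasure
  have hm := (hΦ.gaussian.aemeasurable h)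
  constructor
  · refine inner_eq_zero_of_powerSeries hΦ hf h (φ := fun m => 2 * m)
      (fun a b hab => by simpa using hab) (fun m => (-1) ^ m / (2 * m).factorial) ?_ ?_ ?_
    · intro m
      simp [abs_div, abs_pow]
    · intro x
      convert Real.hasSum_cos x using 1
      ext m
      ring
    · exact MemLp.of_bound (by fun_prop) 1 (Eventually.of_forall fun ω => Real.abs_cos_le_one _)
  · refine inner_eq_zero_of_powerSeries hΦ hf h (φ := fun m => 2 * m + 1)
      (fun a b hab => by simpa using hab) (fun m => (-1) ^ m / (2 * m + 1).factorial) ?_ ?_ ?_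
    · intro m
      simp [abs_div, abs_pow]
    · intro x
      convert Real.hasSum_sin x using 1
      ext m
      ring
    · exact MemLp.of_bound (by fun_prop) 1 (Eventually.of_forall fun ω => Real.abs_sin_le_one _)

theorem integral_mul_cexp_eq_zero (hΦ : IsGaussianField Φ) {f : Lp ℝ 2 P}
    (hf : ∀ p, ⟪f, polyLp hΦ p⟫_ℝ = 0) (h : L) :
    ∫ ω, (f ω : ℂ) * Complex.exp (Φ h ω * Complex.I) ∂P = 0 := by
  have := hΦ.gaussian.isProbabilityMeasure
  have hm := (hΦ.gaussian.aemeasurable h)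
  obtain ⟨hc, hs⟩ := integral_mul_cos_sin_eq_zero hΦ hf h
  have hfi : Integrable f P := (Lp.memLp f).integrable (by norm_num)
  have hci : Integrable (fun ω => f ω * Real.cos (Φ h ω)) P :=
    hfi.mul_bdd (c := 1) (by fun_prop) (Eventually.of_forall fun ω => Real.abs_cos_le_one _)
  have hsi : Integrable (fun ω => f ω * Real.sin (Φ h ω)) P :=
    hfi.mul_bdd (c := 1) (by fun_prop) (Eventually.of_forall fun ω => Real.abs_sin_le_one _)
  have e : ∀ ω, (f ω : ℂ) * Complex.exp (Φ h ω * Complex.I) =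
      ((f ω * Real.cos (Φ h ω) : ℝ) : ℂ) + ((f ω * Real.sin (Φ h ω) : ℝ) : ℂ) * Complex.I := by
    intro ω
    rw [Complex.exp_mul_I]
    push_cast
    ring
  simp only [e]
  rw [integral_add hci.ofReal (hsi.ofReal.mul_const _), integral_mul_const,
    integral_complex_ofReal, integral_complex_ofReal, hc, hs]
  simp

theorem sum_apply_ae (s : Finset L) (c : s → ℝ) :
    ∀ᵐ ω ∂P, Φ (∑ i, c i • (i : L)) ω = ∑ i, c i * Φ (i : L) ω := by
  rw [map_sum]
  have h1 : ∀ᵐ ω ∂P, ∀ i : s, Φ (c i • (i : L)) ω = c i * Φ (i : L) ω := by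
    rw [ae_all_iff]
    intro i
    rw [map_smul]
    filter_upwards [Lp.coeFn_smul (c i) (Φ (i : L))] with ω hω
    rw [hω, Pi.smul_apply, smul_eq_mul]
  filter_upwards [h1, Lp.coeFn_finsetSum Finset.univ (fun i : s => Φ (c i • (i : L)))] with ω h1 h2
  rw [h2, Finset.sum_apply]
  exact Finset.sum_congr rfl fun i _ => h1 i

/-- Power series turn orthogonality to polynomials into `∫ f exp (i Φ h) = 0` for all `h`. So the
finite measures with densities `f⁺` and `f⁻` give the field the same characteristic functions; they
agree on the σ-algebra of the field, hence on all measurable sets up to null sets, and `f⁺ = f⁻`. -/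
theorem eq_zero_of_inner_polyLp (hΦ : IsGaussianField Φ) (hgen : GeneratesSigmaAlgebra Φ)
    {f : Lp ℝ 2 P} (hf : ∀ p, ⟪f, polyLp hΦ p⟫_ℝ = 0) : f = 0 := by
  have := hΦ.gaussian.isProbabilityMeasure
  have hfi : Integrable f P := (Lp.memLp f).integrable (by norm_num)
  have hfm : Measurable f := (Lp.stronglyMeasurable f).measurable
  have hΦm : ∀ h, Measurable (Φ h) := fun h => (Lp.stronglyMeasurable (Φ h)).measurable
  let d₁ : Ω → ENNReal := fun ω => ENNReal.ofReal (f ω)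
  let d₂ : Ω → ENNReal := fun ω => ENNReal.ofReal (-f ω)
  have hd₁ : Measurable d₁ := hfm.ennreal_ofReal
  have hd₂ : Measurable d₂ := hfm.neg.ennreal_ofReal
  have hμ₁ : IsFiniteMeasure (P.withDensity d₁) := isFiniteMeasure_withDensity_ofReal hfi.2
  have hμ₂ : IsFiniteMeasure (P.withDensity d₂) := isFiniteMeasure_withDensity_ofReal hfi.neg.2
  let Ψ : Ω → L → ℝ := fun ω h => Φ h ω
  have hΨ : Measurable Ψ := measurable_pi_lambda _ hΦm
  have hexp : ∀ h : L, Integrable (fun ω => (f ω : ℂ) * Complex.exp (Φ h ω * Complex.I)) P := by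
    intro h
    refine hfi.ofReal.mul_bdd (c := 1) ?_ (Eventually.of_forall fun ω => ?_)
    · have := hΦm h
      fun_prop
    · rw [Complex.norm_exp_ofReal_mul_I]
  have hchar : ∀ h : L, ∫ ω, Complex.exp (Φ h ω * Complex.I) ∂P.withDensity d₁ =
      ∫ ω, Complex.exp (Φ h ω * Complex.I) ∂P.withDensity d₂ := by
    intro h
    have hint : ∀ d : Ω → ℝ, Measurable d → (∀ ω, |d ω| ≤ |f ω|) →
        Integrable (fun ω => d ω • Complex.exp (Φ h ω * Complex.I)) P := by
      intro d hd hdb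
      refine (hexp h).mono ?_ (Eventually.of_forall fun ω => ?_)
      · have := hΦm h
        fun_prop
      · rw [norm_smul, norm_mul, Complex.norm_exp_ofReal_mul_I]
        simpa using hdb ω
    rw [integral_withDensity_eq_integral_toReal_smul hd₁ (by simp [d₁]),
      integral_withDensity_eq_integral_toReal_smul hd₂ (by simp [d₂]), ← sub_eq_zero,
      ← integral_sub, ← integral_mul_cexp_eq_zero hΦ hf h]
    · refine integral_congr_ae (Eventually.of_forall fun ω => ?_)
      simp only [d₁, d₂, ENNReal.toReal_ofReal']
      rw [← sub_smul]
      have : max (f ω) 0 - max (-f ω) 0 = f ω := max_zero_sub_eq_self (f ω)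
      rw [this, Complex.real_smul]
    · refine hint _ hd₁.ennreal_toReal fun ω => ?_
      simp only [d₁, ENNReal.toReal_ofReal']
      rw [abs_of_nonneg (le_max_right _ _)]
      exact max_le (le_abs_self _) (abs_nonneg _)
    · refine hint _ hd₂.ennreal_toReal fun ω => ?_
      simp only [d₂, ENNReal.toReal_ofReal']
      rw [abs_of_nonneg (le_max_right _ _)]
      exact max_le (neg_le_abs _) (abs_nonneg _)
  have hmap : (P.withDensity d₁).map Ψ = (P.withDensity d₂).map Ψ := by
    -- A finite measure on `L → ℝ` is determined by its finite-dimensional marginals, and these by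
    -- their characteristic functions.
    refine IsProjectiveLimit.unique (P := fun I => ((P.withDensity d₂).map Ψ).map I.restrict)
      (fun I => ?_) (fun I => rfl)
    have hr : Measurable (I.restrict (π := fun _ : L => ℝ)) := Finset.measurable_restrict I
    beta_reduce
    rw [Measure.map_map hr hΨ, Measure.map_map hr hΨ]
    refine Measure.ext_of_charFunDual (funext fun Λ => ?_)
    rw [charFunDual_apply, charFunDual_apply]
    classical
    let c : I → ℝ := fun i => Λ (Pi.single i 1)
    -- By linearity of `Φ`, a functional of a finite marginal is again a single field variable, to
    -- which `hchar` applies.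
    have hΛ : ∀ᵐ ω ∂P, Λ ((I.restrict ∘ Ψ) ω) = Φ (∑ i, c i • (i : L)) ω := by
      filter_upwards [sum_apply_ae (Φ := Φ) I c] with ω hω
      rw [hω]
      have := LinearMap.pi_apply_eq_sum_univ (Λ : (I → ℝ) →ₗ[ℝ] ℝ) ((I.restrict ∘ Ψ) ω)
      simp only [ContinuousLinearMap.coe_coe] at this
      rw [this]
      refine Finset.sum_congr rfl fun i _ => ?_
      rw [smul_eq_mul, mul_comm]
      congr 2
      ext j
      simp [Pi.single_apply, eq_comm]
    have hF : AEStronglyMeasurable (fun x : I → ℝ => Complex.exp (Λ x * Complex.I))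
        ((P.withDensity d₁).map (I.restrict ∘ Ψ)) := by fun_prop
    have hF' : AEStronglyMeasurable (fun x : I → ℝ => Complex.exp (Λ x * Complex.I))
        ((P.withDensity d₂).map (I.restrict ∘ Ψ)) := by fun_prop
    rw [integral_map (hr.comp hΨ).aemeasurable hF, integral_map (hr.comp hΨ).aemeasurable hF']
    have hae : ∀ d : Ω → ENNReal, ∫ ω, Complex.exp (Λ ((I.restrict ∘ Ψ) ω) * Complex.I)
        ∂P.withDensity d = ∫ ω, Complex.exp (Φ (∑ i, c i • (i : L)) ω * Complex.I)
        ∂P.withDensity d := by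
      intro d
      refine integral_congr_ae ?_
      filter_upwards [(withDensity_absolutelyContinuous P d).ae_le hΛ] with ω hω
      rw [hω]
    rw [hae, hae, hchar]
  have hsigma : (⨆ h : L, MeasurableSpace.comap (fun ω => Φ h ω) (borel ℝ)) =
      MeasurableSpace.comap Ψ MeasurableSpace.pi := by
    rw [MeasurableSpace.pi, MeasurableSpace.comap_iSup]
    refine iSup_congr fun h => ?_
    rw [MeasurableSpace.comap_comp, ← BorelSpace.measurable_eq]
    rfl
  have hμ : P.withDensity d₁ = P.withDensity d₂ := by
    refine Measure.ext fun A hA => ?_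
    obtain ⟨B, hB, hAB⟩ := hgen A hA
    rw [hsigma] at hB
    obtain ⟨D, hD, rfl⟩ := hB
    rw [measure_congr ((withDensity_absolutelyContinuous P d₁).ae_le hAB),
      measure_congr ((withDensity_absolutelyContinuous P d₂).ae_le hAB),
      ← Measure.map_apply hΨ hD, ← Measure.map_apply hΨ hD, hmap]
  rw [withDensity_eq_iff_of_sigmaFinite hd₁.aemeasurable hd₂.aemeasurable] at hμ
  refine Lp.ext ?_
  filter_upwards [hμ, Lp.coeFn_zero ℝ 2 P] with ω hω h0
  rw [h0, Pi.zero_apply]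
  simp only [d₁, d₂] at hω
  have := congrArg ENNReal.toReal hω
  rw [ENNReal.toReal_ofReal', ENNReal.toReal_ofReal'] at this
  have h3 := max_zero_sub_eq_self (f ω)
  linarith

theorem denseRange_polyLp (hΦ : IsGaussianField Φ) (hgen : GeneratesSigmaAlgebra Φ) :
    DenseRange (polyLp hΦ) := by
  have h : Dense ((LinearMap.range (polyLp hΦ) : Submodule ℝ (Lp ℝ 2 P)) : Set (Lp ℝ 2 P)) := by
    rw [Submodule.dense_iff_topologicalClosure_eq_top, Submodule.topologicalClosure_eq_top_iff,
      Submodule.eq_bot_iff]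
    intro f hf
    refine eq_zero_of_inner_polyLp hΦ hgen fun p => ?_
    rw [real_inner_comm]
    exact (Submodule.mem_orthogonal _ _).1 hf _ ⟨p, rfl⟩
  exact h

end Density

/-! ### A closability criterion and a bound on partial sums. -/

section OperatorTheory

variable {H K : Type*} [NormedAddCommGroup H] [InnerProductSpace ℝ H]
  [NormedAddCommGroup K] [InnerProductSpace ℝ K]

/-- The double adjoint is a closed extension of `A`. -/
theorem isClosable_of_dense_adjoint_domain [CompleteSpace H] [CompleteSpace K] {A : H →ₗ.[ℝ] K}
    (hd : Dense (A.domain : Set H)) (hd' : Dense (A.adjoint.domain : Set K)) : A.IsClosable :=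
  (A.adjoint.adjoint_isClosed hd').isClosable.leIsClosable
    ((A.adjoint_isFormalAdjoint hd).le_adjoint hd')

/-- Without negative cross terms, enlarging a finite index set cannot decrease the norm of the sum.
-/
theorem norm_sum_le_of_hasSum_of_inner_nonneg {ι : Type*} {v : ι → H} {w : H} (hv : HasSum v w)
    (hpos : ∀ i j, 0 ≤ ⟪v i, v j⟫_ℝ) (s : Finset ι) : ‖∑ i ∈ s, v i‖ ≤ ‖w‖ := by
  classical
  refine ge_of_tendsto hv.norm (Filter.eventually_atTop.2 ⟨s, fun t hst => ?_⟩)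
  refine le_of_sq_le_sq ?_ (norm_nonneg _)
  rw [← Finset.sum_sdiff hst, add_comm, norm_add_sq_real]
  have : 0 ≤ ⟪∑ i ∈ s, v i, ∑ i ∈ t \ s, v i⟫_ℝ := by
    rw [sum_inner]
    refine Finset.sum_nonneg fun i _ => ?_
    rw [inner_sum]
    exact Finset.sum_nonneg fun j _ => hpos i j
  nlinarith [sq_nonneg ‖∑ i ∈ t \ s, v i‖]

theorem opMul_mono {E F G : Type*} [AddCommGroup E] [Module ℝ E] [AddCommGroup F] [Module ℝ F]
    [AddCommGroup G] [Module ℝ G] (g : F →ₗ.[ℝ] G) {f f' : E →ₗ.[ℝ] F} (h : f ≤ f') :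
    opMul g f ≤ opMul g f' := by
  have key : ∀ x (hx : x ∈ f.domain), f ⟨x, hx⟩ = f' ⟨x, h.1 hx⟩ := fun x hx => h.2 rfl
  refine ⟨fun x hx => ?_, fun x y hxy => ?_⟩
  · obtain ⟨hx1, hx2⟩ := mem_prodDomain.1 hx
    exact mem_prodDomain.2 ⟨h.1 hx1, key x hx1 ▸ hx2⟩
  · obtain ⟨hx1, hx2⟩ := mem_prodDomain.1 x.2
    obtain ⟨y, hy⟩ := y
    simp only at hxy
    subst hxy
    rw [opMul_apply g f x hx1 hx2, opMul_apply g f' ⟨x, hy⟩ (h.1 hx1) (key x hx1 ▸ hx2)]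
    congr 1
    exact Subtype.ext (key x hx1)

end OperatorTheory

/-! ### The Malliavin derivative, its adjoint, and the number operator. -/

section Malliavin

open MvPolynomial Filter
open scoped Topology

variable {L Ω : Type*} [NormedAddCommGroup L] [InnerProductSpace ℝ L] [MeasurableSpace Ω]
  {P : Measure Ω}

/-- The contraction `G ↦ ⟪G, k⟫` of an `L`-valued random variable with `k`. -/
noncomputable def contract (P : Measure Ω) (k : L) : Lp L 2 P →L[ℝ] Lp ℝ 2 P :=
  (innerSL ℝ k).compLpL 2 P

/-- The elementary tensor `F ↦ F ⊗ k`. -/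
noncomputable def tensor (P : Measure Ω) (k : L) : Lp ℝ 2 P →L[ℝ] Lp L 2 P :=
  (ContinuousLinearMap.toSpanSingleton ℝ k).compLpL 2 P

theorem coeFn_contract (k : L) (G : Lp L 2 P) :
    contract P k G =ᵐ[P] fun ω => ⟪k, G ω⟫_ℝ :=
  ContinuousLinearMap.coeFn_compLpL _ _

theorem coeFn_tensor (k : L) (F : Lp ℝ 2 P) :
    tensor P k F =ᵐ[P] fun ω => F ω • k :=
  ContinuousLinearMap.coeFn_compLpL _ _

theorem inner_tensor (k : L) (F : Lp ℝ 2 P) (G : Lp L 2 P) :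
    ⟪tensor P k F, G⟫_ℝ = ⟪F, contract P k G⟫_ℝ := by
  rw [L2.inner_def, L2.inner_def]
  refine integral_congr_ae ?_
  filter_upwards [coeFn_contract k G, coeFn_tensor k F] with ω h1 h2
  rw [h1, h2, inner_smul_left]
  simp [mul_comm]

theorem contract_tensor (k h : L) (F : Lp ℝ 2 P) :
    contract P k (tensor P h F) = ⟪h, k⟫_ℝ • F := by
  refine Lp.ext ?_
  filter_upwards [coeFn_contract k (tensor P h F), coeFn_tensor h F,
    Lp.coeFn_smul ⟪h, k⟫_ℝ F] with ω h1 h2 h3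
  rw [h1, h2, h3, inner_smul_right, Pi.smul_apply, smul_eq_mul, mul_comm, real_inner_comm]

/-- Each contraction is known only almost everywhere; countability of the basis yields one common
null set. -/
theorem ext_contract (e : HilbertBasis ℕ ℝ L) {G G' : Lp L 2 P}
    (h : ∀ k, contract P k G = contract P k G') : G = G' := by
  refine Lp.ext ?_
  have hae : ∀ᵐ ω ∂P, ∀ i, ⟪e i, G ω⟫_ℝ = ⟪e i, G' ω⟫_ℝ := by
    rw [ae_all_iff]
    intro i
    have h2 := coeFn_contract (e i) G'
    rw [← h (e i)] at h2
    filter_upwards [coeFn_contract (e i) G, h2] with ω h1 h2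
    rw [← h1, h2]
  filter_upwards [hae] with ω hω
  refine e.repr.injective (lp.ext (funext fun i => ?_))
  rw [e.repr_apply_apply, e.repr_apply_apply, hω i]

variable {Φ : L →ₗ[ℝ] Lp ℝ 2 P}

theorem inner_polyLp (hΦ : IsGaussianField Φ) (p q : MvPolynomial L ℝ) :
    ⟪polyLp hΦ p, polyLp hΦ q⟫_ℝ = ∫ ω, polyEval Φ (p * q) ω ∂P := by
  rw [L2.inner_def]
  refine integral_congr_ae ?_
  filter_upwards [coeFn_polyLp hΦ p, coeFn_polyLp hΦ q] with ω h1 h2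
  rw [h1, h2]
  simp [polyEval, mul_comm]

/-- Gaussian integration by parts for `p * q`, combined with the Leibniz rule. -/
theorem inner_polyLp_creation (hΦ : IsGaussianField Φ) (k : L) (p q : MvPolynomial L ℝ) :
    ⟪polyLp hΦ p, polyLp hΦ (creation k q)⟫_ℝ = ⟪polyLp hΦ (dirDeriv k p), polyLp hΦ q⟫_ℝ := by
  have h := integral_mul_polyEval hΦ k (p * q)
  rw [inner_polyLp, inner_polyLp]
  have e1 : ∀ ω, polyEval Φ (p * creation k q) ω =
      Φ k ω * polyEval Φ (p * q) ω - polyEval Φ (p * dirDeriv k q) ω := by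
    intro ω
    simp only [creation_apply, polyEval, map_mul, map_sub, eval_X]
    ring
  have e2 : ∀ ω, polyEval Φ (dirDeriv k (p * q)) ω =
      polyEval Φ (p * dirDeriv k q) ω + polyEval Φ (dirDeriv k p * q) ω := by
    intro ω
    simp only [Derivation.leibniz, polyEval, map_mul, map_add, smul_eq_mul]
    ring
  have e3 : ∀ ω, Φ k ω * polyEval Φ (p * q) ω = polyEval Φ (X k * (p * q)) ω := by
    intro ω
    simp [polyEval]
  simp only [e1, e3] at h ⊢
  rw [integral_sub (integrable_polyEval hΦ _) (integrable_polyEval hΦ _), h]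
  simp only [e2]
  rw [integral_add (integrable_polyEval hΦ _) (integrable_polyEval hΦ _)]
  ring

/-- For orthogonal directions `creation b` commutes with `dirDeriv a`, so the inner product equals
`‖D_a D_b p‖²`. -/
theorem inner_creation_dirDeriv_nonneg (hΦ : IsGaussianField Φ) {a b : L} (hab : ⟪b, a⟫_ℝ = 0)
    (p : MvPolynomial L ℝ) :
    0 ≤ ⟪polyLp hΦ (creation a (dirDeriv a p)), polyLp hΦ (creation b (dirDeriv b p))⟫_ℝ := by
  rw [real_inner_comm, inner_polyLp_creation, dirDeriv_creation, hab, zero_smul, zero_add,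
    real_inner_comm, inner_polyLp_creation, dirDeriv_comm]
  exact real_inner_self_nonneg

theorem eq_of_inner_polyLp (hΦ : IsGaussianField Φ) (hgen : GeneratesSigmaAlgebra Φ)
    {f g : Lp ℝ 2 P} (h : ∀ p, ⟪polyLp hΦ p, f⟫_ℝ = ⟪polyLp hΦ p, g⟫_ℝ) : f = g := by
  rw [← sub_eq_zero]
  refine eq_zero_of_inner_polyLp hΦ hgen fun p => ?_
  rw [real_inner_comm, inner_sub_right, h, sub_self]

/-- This makes the derivative independent of the polynomial representing a random variable: `D_k p`
pairs with `q` as `p` pairs with `creation k q`. -/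
theorem polyLp_dirDeriv_eq_zero (hΦ : IsGaussianField Φ) (hgen : GeneratesSigmaAlgebra Φ) (k : L)
    {p : MvPolynomial L ℝ} (hp : polyLp hΦ p = 0) : polyLp hΦ (dirDeriv k p) = 0 := by
  refine eq_of_inner_polyLp hΦ hgen fun q => ?_
  rw [real_inner_comm, ← inner_polyLp_creation, hp]
  simp

theorem polyLp_dirDeriv_congr (hΦ : IsGaussianField Φ) (hgen : GeneratesSigmaAlgebra Φ) (k : L)
    {p q : MvPolynomial L ℝ} (hpq : polyLp hΦ p = polyLp hΦ q) :
    polyLp hΦ (dirDeriv k p) = polyLp hΦ (dirDeriv k q) := by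
  rw [← sub_eq_zero, ← map_sub, ← map_sub]
  exact polyLp_dirDeriv_eq_zero hΦ hgen k (by rw [map_sub, hpq, sub_self])

theorem contract_sum_tensor (hΦ : IsGaussianField Φ) {n : ℕ} (h : Fin n → L)
    (q : MvPolynomial (Fin n) ℝ) (k : L) :
    contract P k (∑ j, tensor P (h j) (polyLp hΦ (rename h (pderiv j q)))) =
      polyLp hΦ (dirDeriv k (rename h q)) := by
  rw [dirDeriv_rename, map_sum, map_sum]
  simp only [contract_tensor, map_smul]

theorem coeFn_sum_tensor (hΦ : IsGaussianField Φ) {n : ℕ} (h : Fin n → L)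
    (q : MvPolynomial (Fin n) ℝ) :
    (∑ j, tensor P (h j) (polyLp hΦ (rename h (pderiv j q))) : Lp L 2 P) =ᵐ[P]
      polyGrad Φ h q := by
  have h1 : ∀ᵐ ω ∂P, ∀ j, tensor P (h j) (polyLp hΦ (rename h (pderiv j q))) ω =
      polyFun Φ h (pderiv j q) ω • h j := by
    rw [ae_all_iff]
    intro j
    filter_upwards [coeFn_tensor (h j) (polyLp hΦ (rename h (pderiv j q))),
      coeFn_polyLp hΦ (rename h (pderiv j q))] with ω h1 h2
    rw [h1, h2, polyFun_eq_polyEval]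
  filter_upwards [h1, Lp.coeFn_finsetSum Finset.univ
    (fun j => tensor P (h j) (polyLp hΦ (rename h (pderiv j q))))] with ω h1 h2
  rw [h2, Finset.sum_apply, polyGrad]
  exact Finset.sum_congr rfl fun j _ => h1 j

/-- Describing the gradient by its contractions removes the choice of `h₁, …, hₙ`, so sums of
generators are handled by adding polynomials. -/
theorem mem_malliavinGraph_iff (hΦ : IsGaussianField Φ) (e : HilbertBasis ℕ ℝ L)
    {F : Lp ℝ 2 P} {G : Lp L 2 P} :
    (F, G) ∈ malliavinGraph Φ ↔
      ∃ p, polyLp hΦ p = F ∧ ∀ k, contract P k G = polyLp hΦ (dirDeriv k p) := by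
  constructor
  · intro hFG
    refine Submodule.span_induction (p := fun z _ => ∃ p, polyLp hΦ p = z.1 ∧
      ∀ k, contract P k z.2 = polyLp hΦ (dirDeriv k p)) ?_ ?_ ?_ ?_ hFG
    · rintro ⟨F, G⟩ ⟨n, h, q, h1, h2⟩
      refine ⟨rename h q, Lp.ext ?_, fun k => ?_⟩
      · refine (coeFn_polyLp hΦ _).trans ?_
        rw [← polyFun_eq_polyEval]
        exact h1.symm
      · rw [← contract_sum_tensor]
        congr 1
        exact Lp.ext (h2.trans (coeFn_sum_tensor hΦ h q).symm)
    · exact ⟨0, by simp, by simp⟩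
    · rintro x y _ _ ⟨p, hp, hp'⟩ ⟨q, hq, hq'⟩
      exact ⟨p + q, by simp [hp, hq], fun k => by simp [hp', hq']⟩
    · rintro a x _ ⟨p, hp, hp'⟩
      exact ⟨a • p, by simp [hp], fun k => by simp [hp']⟩
  · rintro ⟨p, rfl, hp⟩
    obtain ⟨n, h, -, q, rfl⟩ := p.exists_fin_rename
    have hG : G = ∑ j, tensor P (h j) (polyLp hΦ (rename h (pderiv j q))) :=
      ext_contract e fun k => by rw [hp, contract_sum_tensor]
    refine Submodule.subset_span ⟨n, h, q, ?_, ?_⟩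
    · rw [polyFun_eq_polyEval]
      exact coeFn_polyLp hΦ _
    · rw [hG]
      exact coeFn_sum_tensor hΦ h q

theorem mem_malliavin_graph_iff (hΦ : IsGaussianField Φ) (hgen : GeneratesSigmaAlgebra Φ)
    (e : HilbertBasis ℕ ℝ L) {F : Lp ℝ 2 P} {G : Lp L 2 P} :
    (F, G) ∈ (malliavin Φ).graph ↔
      ∃ p, polyLp hΦ p = F ∧ ∀ k, contract P k G = polyLp hΦ (dirDeriv k p) := by
  rw [malliavin, Submodule.toLinearPMap_graph_eq, mem_malliavinGraph_iff hΦ e]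
  rintro ⟨F, G⟩ hFG h0
  obtain ⟨p, hp, hp'⟩ := (mem_malliavinGraph_iff hΦ e).1 hFG
  simp only at h0 ⊢
  refine ext_contract e fun k => ?_
  rw [hp' k, map_zero, polyLp_dirDeriv_eq_zero hΦ hgen k (hp.trans h0)]

theorem mem_malliavin_domain_iff (hΦ : IsGaussianField Φ) (hgen : GeneratesSigmaAlgebra Φ)
    (e : HilbertBasis ℕ ℝ L) {F : Lp ℝ 2 P} :
    F ∈ (malliavin Φ).domain ↔ ∃ p, polyLp hΦ p = F := by
  rw [LinearPMap.mem_domain_iff]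
  constructor
  · rintro ⟨G, hG⟩
    obtain ⟨p, hp, -⟩ := (mem_malliavin_graph_iff hΦ hgen e).1 hG
    exact ⟨p, hp⟩
  · rintro ⟨p, rfl⟩
    obtain ⟨n, h, -, q, rfl⟩ := p.exists_fin_rename
    exact ⟨_, (mem_malliavin_graph_iff hΦ hgen e).2
      ⟨_, rfl, fun k => contract_sum_tensor hΦ h q k⟩⟩

theorem contract_malliavin (hΦ : IsGaussianField Φ) (hgen : GeneratesSigmaAlgebra Φ)
    (e : HilbertBasis ℕ ℝ L) {p : MvPolynomial L ℝ} (hp : polyLp hΦ p ∈ (malliavin Φ).domain)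
    (k : L) : contract P k (malliavin Φ ⟨polyLp hΦ p, hp⟩) = polyLp hΦ (dirDeriv k p) := by
  obtain ⟨p', hp', hk⟩ := (mem_malliavin_graph_iff hΦ hgen e).1
    ((malliavin Φ).mem_graph ⟨polyLp hΦ p, hp⟩)
  rw [hk, polyLp_dirDeriv_congr hΦ hgen k hp']

theorem malliavin_rename (hΦ : IsGaussianField Φ) (hgen : GeneratesSigmaAlgebra Φ)
    (e : HilbertBasis ℕ ℝ L) {n : ℕ} (h : Fin n → L) (q : MvPolynomial (Fin n) ℝ)
    (hp : polyLp hΦ (rename h q) ∈ (malliavin Φ).domain) :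
    malliavin Φ ⟨polyLp hΦ (rename h q), hp⟩ =
      ∑ j, tensor P (h j) (polyLp hΦ (rename h (pderiv j q))) :=
  ext_contract e fun k => by rw [contract_malliavin hΦ hgen e, contract_sum_tensor]

theorem malliavinDir_apply (hΦ : IsGaussianField Φ) (hgen : GeneratesSigmaAlgebra Φ)
    (e : HilbertBasis ℕ ℝ L) {p : MvPolynomial L ℝ} (k : L)
    (hp : polyLp hΦ p ∈ (malliavinDir Φ k).domain) :
    malliavinDir Φ k ⟨polyLp hΦ p, hp⟩ = polyLp hΦ (dirDeriv k p) :=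
  contract_malliavin hΦ hgen e hp k

theorem dense_malliavin_domain (hΦ : IsGaussianField Φ) (hgen : GeneratesSigmaAlgebra Φ)
    (e : HilbertBasis ℕ ℝ L) : Dense ((malliavin Φ).domain : Set (Lp ℝ 2 P)) := by
  refine (denseRange_polyLp hΦ hgen).mono ?_
  rintro _ ⟨p, rfl⟩
  exact (mem_malliavin_domain_iff hΦ hgen e).2 ⟨p, rfl⟩

theorem mem_adjoint_malliavinDir (hΦ : IsGaussianField Φ) (hgen : GeneratesSigmaAlgebra Φ)
    (e : HilbertBasis ℕ ℝ L) (k : L) (q : MvPolynomial L ℝ) :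
    ∃ hq : polyLp hΦ q ∈ (malliavinDir Φ k).adjoint.domain,
      (malliavinDir Φ k).adjoint ⟨polyLp hΦ q, hq⟩ = polyLp hΦ (creation k q) := by
  have key : ∀ x : (malliavinDir Φ k).domain,
      ⟪polyLp hΦ (creation k q), (x : Lp ℝ 2 P)⟫_ℝ = ⟪polyLp hΦ q, malliavinDir Φ k x⟫_ℝ := by
    rintro ⟨x, hx⟩
    obtain ⟨p, rfl⟩ := (mem_malliavin_domain_iff hΦ hgen e).1 hx
    rw [malliavinDir_apply hΦ hgen e, real_inner_comm, inner_polyLp_creation, real_inner_comm]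
  have hq := LinearPMap.mem_adjoint_domain_of_exists (polyLp hΦ q) ⟨_, key⟩
  exact ⟨hq, LinearPMap.adjoint_apply_eq (T := malliavinDir Φ k)
    (dense_malliavin_domain hΦ hgen e) ⟨polyLp hΦ q, hq⟩ key⟩

theorem isClosable_malliavinDir (hΦ : IsGaussianField Φ) (hgen : GeneratesSigmaAlgebra Φ)
    (e : HilbertBasis ℕ ℝ L) (k : L) : (malliavinDir Φ k).IsClosable := by
  refine isClosable_of_dense_adjoint_domain (dense_malliavin_domain hΦ hgen e)
    ((denseRange_polyLp hΦ hgen).mono ?_)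
  rintro _ ⟨q, rfl⟩
  exact (mem_adjoint_malliavinDir hΦ hgen e k q).1

theorem mem_graph_opMul_malliavinDir (hΦ : IsGaussianField Φ) (hgen : GeneratesSigmaAlgebra Φ)
    (e : HilbertBasis ℕ ℝ L) (k : L) (p : MvPolynomial L ℝ) :
    (polyLp hΦ p, polyLp hΦ (creation k (dirDeriv k p))) ∈
      (opMul (malliavinDir Φ k).adjoint (malliavinDir Φ k)).graph := by
  have hp : polyLp hΦ p ∈ (malliavinDir Φ k).domain :=
    (mem_malliavin_domain_iff hΦ hgen e).2 ⟨p, rfl⟩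
  obtain ⟨h1, h2⟩ := mem_adjoint_malliavinDir hΦ hgen e k (dirDeriv k p)
  have hmem : malliavinDir Φ k ⟨polyLp hΦ p, hp⟩ ∈ (malliavinDir Φ k).adjoint.domain := by
    rw [malliavinDir_apply hΦ hgen e]
    exact h1
  have hx : polyLp hΦ p ∈ (opMul (malliavinDir Φ k).adjoint (malliavinDir Φ k)).domain :=
    mem_prodDomain.2 ⟨hp, hmem⟩
  refine (LinearPMap.mem_graph_iff _).2 ⟨⟨_, hx⟩, rfl, ?_⟩
  rw [opMul_apply _ _ ⟨_, hx⟩ hp hmem, ← h2]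
  congr 1
  exact Subtype.ext (malliavinDir_apply hΦ hgen e k hp)

/-- The commutation relation gives `‖creation k r‖² = ‖k‖² ‖r‖² + ‖D_k r‖²`, and `D_k r` is the
contraction of a fixed gradient with `k`. -/
theorem norm_polyLp_creation_le (hΦ : IsGaussianField Φ) (r : MvPolynomial L ℝ) :
    ∃ C, ∀ k, ‖polyLp hΦ (creation k r)‖ ≤ C * ‖k‖ := by
  obtain ⟨n, h, -, q, rfl⟩ := r.exists_fin_rename
  set G : Lp L 2 P := ∑ j, tensor P (h j) (polyLp hΦ (rename h (pderiv j q))) with hG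
  refine ⟨‖polyLp hΦ (rename h q)‖ + ‖G‖, fun k => ?_⟩
  have h1 : ‖polyLp hΦ (dirDeriv k (rename h q))‖ ≤ ‖k‖ * ‖G‖ := by
    rw [← contract_sum_tensor, ← hG]
    refine (ContinuousLinearMap.norm_compLp_le _ _).trans_eq ?_
    rw [innerSL_apply_norm]
  have h2 : ‖polyLp hΦ (creation k (rename h q))‖ ^ 2 =
      ‖k‖ ^ 2 * ‖polyLp hΦ (rename h q)‖ ^ 2 + ‖polyLp hΦ (dirDeriv k (rename h q))‖ ^ 2 := by
    rw [← real_inner_self_eq_norm_sq, inner_polyLp_creation, dirDeriv_creation, map_add, map_smul,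
      inner_add_left, inner_smul_left, real_inner_self_eq_norm_sq, real_inner_self_eq_norm_sq,
      real_inner_comm, inner_polyLp_creation, real_inner_self_eq_norm_sq]
    rfl
  refine le_of_sq_le_sq ?_ (by positivity)
  rw [h2]
  have h3 := pow_le_pow_left₀ (norm_nonneg _) h1 2
  have h4 : 0 ≤ ‖k‖ ^ 2 * (‖polyLp hΦ (rename h q)‖ * ‖G‖) := by positivity
  nlinarith

/-- The map `k ↦ (X_k - D_k) r` with values in `L²`. -/
theorem exists_creation_clm (hΦ : IsGaussianField Φ) (hgen : GeneratesSigmaAlgebra Φ)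
    (r : MvPolynomial L ℝ) :
    ∃ A : L →L[ℝ] Lp ℝ 2 P, ∀ k, A k = polyLp hΦ (creation k r) := by
  obtain ⟨C, hC⟩ := norm_polyLp_creation_le hΦ r
  have hadd : ∀ a b : L, dirDeriv (a + b) = dirDeriv a + dirDeriv b := fun a b =>
    derivation_ext fun i => by simp [inner_add_right]
  have hsmul : ∀ (c : ℝ) (a : L), dirDeriv (c • a) = c • dirDeriv a := fun c a =>
    derivation_ext fun i => by simp [inner_smul_right, MvPolynomial.smul_eq_C_mul]
  -- The indeterminate `X (a + b)` is not `X a + X b`, so linearity in `k` holds only in `L²`.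
  -- Testing against polynomials reduces it to linearity of `dirDeriv`.
  let A : L →ₗ[ℝ] Lp ℝ 2 P :=
    { toFun k := polyLp hΦ (creation k r)
      map_add' a b := eq_of_inner_polyLp hΦ hgen fun p => by
        rw [inner_add_right]
        simp only [inner_polyLp_creation, hadd, Derivation.add_apply, map_add, inner_add_left]
      map_smul' c a := eq_of_inner_polyLp hΦ hgen fun p => by
        rw [inner_smul_right]
        simp only [inner_polyLp_creation, hsmul, Derivation.smul_apply, map_smul, inner_smul_left]
        rfl }
  exact ⟨A.mkContinuous C hC, fun k => rfl⟩

/-- Each `h j` is expanded in the basis, and the continuous linear map `k ↦ creation k r` carries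
the expansion into `L²`. The sum therefore does not depend on the basis. -/
theorem hasSum_creation_dirDeriv (hΦ : IsGaussianField Φ) (hgen : GeneratesSigmaAlgebra Φ)
    (e : HilbertBasis ℕ ℝ L) {n : ℕ} (h : Fin n → L) (q : MvPolynomial (Fin n) ℝ) :
    HasSum (fun i => polyLp hΦ (creation (e i) (dirDeriv (e i) (rename h q))))
      (∑ j, polyLp hΦ (creation (h j) (rename h (pderiv j q)))) := by
  choose A hA using fun j => exists_creation_clm hΦ hgen (rename h (pderiv j q))
  have h1 : ∀ j, HasSum (fun i => ⟪h j, e i⟫_ℝ • polyLp hΦ (creation (e i) (rename h (pderiv j q))))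
      (polyLp hΦ (creation (h j) (rename h (pderiv j q)))) := by
    intro j
    have := (e.hasSum_repr (h j)).mapL (A j)
    simp only [map_smul] at this
    simp only [hA, e.repr_apply_apply] at this
    simpa only [real_inner_comm] using this
  have h2 := hasSum_sum (s := Finset.univ) fun j _ => h1 j
  convert h2 using 1
  ext1 i
  rw [dirDeriv_rename, map_sum, map_sum]
  simp only [map_smul]

theorem mem_adjoint_malliavin (hΦ : IsGaussianField Φ) (hgen : GeneratesSigmaAlgebra Φ)
    (e : HilbertBasis ℕ ℝ L) (k : L) (q : MvPolynomial L ℝ) :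
    ∃ hq : tensor P k (polyLp hΦ q) ∈ (malliavin Φ).adjoint.domain,
      (malliavin Φ).adjoint ⟨tensor P k (polyLp hΦ q), hq⟩ = polyLp hΦ (creation k q) := by
  have key : ∀ x : (malliavin Φ).domain,
      ⟪polyLp hΦ (creation k q), (x : Lp ℝ 2 P)⟫_ℝ =
        ⟪tensor P k (polyLp hΦ q), malliavin Φ x⟫_ℝ := by
    rintro ⟨x, hx⟩
    obtain ⟨p, rfl⟩ := (mem_malliavin_domain_iff hΦ hgen e).1 hx
    rw [inner_tensor, contract_malliavin hΦ hgen e, real_inner_comm, inner_polyLp_creation,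
      real_inner_comm]
  have hq : tensor P k (polyLp hΦ q) ∈ (malliavin Φ).adjoint.domain :=
    LinearPMap.mem_adjoint_domain_of_exists (T := malliavin Φ) _ ⟨_, key⟩
  exact ⟨hq, LinearPMap.adjoint_apply_eq (T := malliavin Φ) (dense_malliavin_domain hΦ hgen e)
    ⟨tensor P k (polyLp hΦ q), hq⟩ key⟩

theorem mem_graph_adjMulClosure (hΦ : IsGaussianField Φ) (hgen : GeneratesSigmaAlgebra Φ)
    (e : HilbertBasis ℕ ℝ L) {n : ℕ} (h : Fin n → L) (q : MvPolynomial (Fin n) ℝ) :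
    (polyLp hΦ (rename h q), ∑ j, polyLp hΦ (creation (h j) (rename h (pderiv j q)))) ∈
      (adjMulClosure Φ).graph := by
  have hp := (mem_malliavin_domain_iff hΦ hgen e).2 ⟨rename h q, rfl⟩
  have hd := fun j => (mem_adjoint_malliavin hΦ hgen e (h j) (rename h (pderiv j q)))
  choose hd1 hd2 using hd
  have hT := malliavin_rename hΦ hgen e h q hp
  have hmem : malliavin Φ ⟨polyLp hΦ (rename h q), hp⟩ ∈ (malliavin Φ).adjoint.domain := by
    rw [hT]
    exact Submodule.sum_mem _ fun j _ => hd1 j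
  have hx : polyLp hΦ (rename h q) ∈ (opMul (malliavin Φ).adjoint (malliavin Φ)).domain :=
    mem_prodDomain.2 ⟨hp, hmem⟩
  refine LinearPMap.le_graph_of_le (opMul_mono _ (malliavin Φ).le_closure)
    ((LinearPMap.mem_graph_iff _).2 ⟨⟨_, hx⟩, rfl, ?_⟩)
  rw [opMul_apply _ _ ⟨_, hx⟩ hp hmem]
  have e1 : (⟨malliavin Φ ⟨polyLp hΦ (rename h q), hp⟩, hmem⟩ : (malliavin Φ).adjoint.domain) =
      ∑ j, ⟨_, hd1 j⟩ := by
    refine Subtype.ext (hT.trans ?_)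
    simp
  rw [e1]
  change (malliavin Φ).adjoint.toFun _ = _
  rw [map_sum]
  exact Finset.sum_congr rfl fun j _ => hd2 j

theorem mem_graph_numberOpPoly (hΦ : IsGaussianField Φ) (hgen : GeneratesSigmaAlgebra Φ)
    (e : HilbertBasis ℕ ℝ L) {n : ℕ} (h : Fin n → L) (q : MvPolynomial (Fin n) ℝ) :
    (polyLp hΦ (rename h q), ∑ j, polyLp hΦ (creation (h j) (rename h (pderiv j q)))) ∈
      (numberOpPoly Φ e).graph := by
  have hg := fun i => mem_graph_opMul_malliavinDir hΦ hgen e (e i) (rename h q)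
  have hd := fun i => LinearPMap.mem_domain_of_mem_graph (hg i)
  have hv : ∀ i, opMul (malliavinDir Φ (e i)).adjoint (malliavinDir Φ (e i)) ⟨_, hd i⟩ =
      polyLp hΦ (creation (e i) (dirDeriv (e i) (rename h q))) := fun i =>
    LinearPMap.mem_graph_snd_inj _ (LinearPMap.mem_graph _ ⟨_, hd i⟩) (hg i) rfl
  have hs := hasSum_creation_dirDeriv hΦ hgen e h q
  simp only [← hv] at hs
  have hx : polyLp hΦ (rename h q) ∈ (numberOpPoly Φ e).domain := ⟨hd, hs.summable⟩
  exact (LinearPMap.mem_graph_iff _).2 ⟨⟨_, hx⟩, rfl,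
    (opSeries_hasSum _ ⟨polyLp hΦ (rename h q), hx⟩ hd).unique hs⟩

theorem numberOpPoly_domain (hΦ : IsGaussianField Φ) (hgen : GeneratesSigmaAlgebra Φ)
    (e : HilbertBasis ℕ ℝ L) : (numberOpPoly Φ e).domain = (malliavin Φ).domain := by
  refine le_antisymm (fun x hx => ?_) fun x hx => ?_
  -- Any single index suffices, since every factor has domain `𝒟`.
  · exact (mem_prodDomain.1 (hx.choose 0)).choose
  · obtain ⟨p, rfl⟩ := (mem_malliavin_domain_iff hΦ hgen e).1 hx
    obtain ⟨n, h, -, q, rfl⟩ := p.exists_fin_rename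
    exact LinearPMap.mem_domain_of_mem_graph (mem_graph_numberOpPoly hΦ hgen e h q)

theorem exists_rename_of_mem_numberOpPoly_domain (hΦ : IsGaussianField Φ)
    (hgen : GeneratesSigmaAlgebra Φ) (e : HilbertBasis ℕ ℝ L) (x : (numberOpPoly Φ e).domain) :
    ∃ (n : ℕ) (h : Fin n → L) (q : MvPolynomial (Fin n) ℝ),
      (x : Lp ℝ 2 P) = polyLp hΦ (rename h q) ∧
      numberOpPoly Φ e x = ∑ j, polyLp hΦ (creation (h j) (rename h (pderiv j q))) := by
  have hx : (x : Lp ℝ 2 P) ∈ (malliavin Φ).domain := by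
    rw [← numberOpPoly_domain hΦ hgen e]
    exact x.2
  obtain ⟨p, hp⟩ := (mem_malliavin_domain_iff hΦ hgen e).1 hx
  obtain ⟨n, h, -, q, rfl⟩ := p.exists_fin_rename
  exact ⟨n, h, q, hp.symm, LinearPMap.mem_graph_snd_inj _ (LinearPMap.mem_graph _ x)
    (mem_graph_numberOpPoly hΦ hgen e h q) hp.symm⟩

theorem numberOpPoly_le (hΦ : IsGaussianField Φ) (hgen : GeneratesSigmaAlgebra Φ)
    (e : HilbertBasis ℕ ℝ L) : numberOpPoly Φ e ≤ adjMulClosure Φ := by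
  refine LinearPMap.le_of_le_graph ?_
  rintro ⟨a, b⟩ hab
  obtain ⟨x, hx1, hx2⟩ := (LinearPMap.mem_graph_iff _).1 hab
  obtain ⟨n, h, q, h1, h2⟩ := exists_rename_of_mem_numberOpPoly_domain hΦ hgen e x
  simp only at hx1 hx2
  rw [← hx1, ← hx2, h1, h2]
  exact mem_graph_adjMulClosure hΦ hgen e h q

theorem dense_range_add_numberOpPoly (hΦ : IsGaussianField Φ) (hgen : GeneratesSigmaAlgebra Φ)
    (e : HilbertBasis ℕ ℝ L) :
    Dense (Set.range fun x : (numberOpPoly Φ e).domain => (x : Lp ℝ 2 P) + numberOpPoly Φ e x) := by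
  refine (denseRange_polyLp hΦ hgen).mono ?_
  rintro _ ⟨p, rfl⟩
  obtain ⟨n, h, -, q, rfl⟩ := p.exists_fin_rename
  obtain ⟨q', hq'⟩ := exists_add_number h q
  obtain ⟨x, hx1, hx2⟩ := (LinearPMap.mem_graph_iff _).1 (mem_graph_numberOpPoly hΦ hgen e h q')
  refine ⟨x, ?_⟩
  simp only at hx1 hx2 ⊢
  rw [hx1, hx2, ← hq', map_add, map_sum]

variable [CompleteSpace L]

/-- The adjoint domain contains all tensors of polynomials with vectors; whatever is orthogonal to
these has vanishing contractions. -/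
theorem isClosable_malliavin (hΦ : IsGaussianField Φ) (hgen : GeneratesSigmaAlgebra Φ)
    (e : HilbertBasis ℕ ℝ L) : (malliavin Φ).IsClosable := by
  refine isClosable_of_dense_adjoint_domain (dense_malliavin_domain hΦ hgen e) ?_
  rw [Submodule.dense_iff_topologicalClosure_eq_top, Submodule.topologicalClosure_eq_top_iff,
    Submodule.eq_bot_iff]
  intro G hG
  refine ext_contract e fun k => ?_
  rw [map_zero]
  refine eq_of_inner_polyLp hΦ hgen fun q => ?_
  rw [← inner_tensor, inner_zero_right]
  exact (Submodule.mem_orthogonal _ _).1 hG _ (mem_adjoint_malliavin hΦ hgen e k q).1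

theorem isSelfAdjoint_adjMulClosure (hΦ : IsGaussianField Φ) (hgen : GeneratesSigmaAlgebra Φ)
    (e : HilbertBasis ℕ ℝ L) : IsSelfAdjoint (adjMulClosure Φ) :=
  isSelfAdjoint_opMul_adjoint_closure (dense_malliavin_domain hΦ hgen e)
    (isClosable_malliavin hΦ hgen e)

theorem closure_numberOpPoly (hΦ : IsGaussianField Φ) (hgen : GeneratesSigmaAlgebra Φ)
    (e : HilbertBasis ℕ ℝ L) :
    (numberOpPoly Φ e).IsClosable ∧ (numberOpPoly Φ e).closure = adjMulClosure Φ :=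
  closure_eq_of_dense (numberOpPoly_le hΦ hgen e) (isSelfAdjoint_adjMulClosure hΦ hgen e).isClosed
    (opMul_adjoint_closure_nonneg (dense_malliavin_domain hΦ hgen e)
      (isClosable_malliavin hΦ hgen e)) (dense_range_add_numberOpPoly hΦ hgen e)

theorem adjMulClosure_eq_numberOp (hΦ : IsGaussianField Φ) (hgen : GeneratesSigmaAlgebra Φ)
    (e : HilbertBasis ℕ ℝ L) : adjMulClosure Φ = numberOp Φ e := by
  have hdense : ∀ i, Dense ((malliavinDir Φ (e i)).domain : Set (Lp ℝ 2 P)) := fun i =>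
    dense_malliavin_domain hΦ hgen e
  have hclos : ∀ i, (malliavinDir Φ (e i)).IsClosable := fun i =>
    isClosable_malliavinDir hΦ hgen e (e i)
  have hgraph : ∀ i p, (polyLp hΦ p, polyLp hΦ (creation (e i) (dirDeriv (e i) p))) ∈
      (opMul (malliavinDir Φ (e i)).adjoint (malliavinDir Φ (e i)).closure).graph := fun i p =>
    LinearPMap.le_graph_of_le (opMul_mono _ (malliavinDir Φ (e i)).le_closure)
      (mem_graph_opMul_malliavinDir hΦ hgen e (e i) p)
  have hdom : ∀ i, (numberOpPoly Φ e).domain ≤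
      (opMul (malliavinDir Φ (e i)).adjoint (malliavinDir Φ (e i)).closure).domain := by
    intro i x hx
    obtain ⟨n, h, q, h1, -⟩ := exists_rename_of_mem_numberOpPoly_domain hΦ hgen e ⟨x, hx⟩
    simp only at h1
    rw [h1]
    exact LinearPMap.mem_domain_of_mem_graph (hgraph i _)
  have hval : ∀ x : (numberOpPoly Φ e).domain, ∃ (n : ℕ) (h : Fin n → L)
      (q : MvPolynomial (Fin n) ℝ),
      numberOpPoly Φ e x = ∑ j, polyLp hΦ (creation (h j) (rename h (pderiv j q))) ∧
      ∀ i, opMul (malliavinDir Φ (e i)).adjoint (malliavinDir Φ (e i)).closure ⟨x, hdom i x.2⟩ =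
        polyLp hΦ (creation (e i) (dirDeriv (e i) (rename h q))) := by
    intro x
    obtain ⟨n, h, q, h1, h2⟩ := exists_rename_of_mem_numberOpPoly_domain hΦ hgen e x
    exact ⟨n, h, q, h2, fun i => LinearPMap.mem_graph_snd_inj _
      (LinearPMap.mem_graph _ ⟨(x : Lp ℝ 2 P), hdom i x.2⟩) (hgraph i _) h1⟩
  have hsum : ∀ x : (numberOpPoly Φ e).domain, HasSum (fun i =>
      opMul (malliavinDir Φ (e i)).adjoint (malliavinDir Φ (e i)).closure ⟨x, hdom i x.2⟩)
      (numberOpPoly Φ e x) := by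
    intro x
    obtain ⟨n, h, q, h2, h3⟩ := hval x
    simp only [h2, h3]
    exact hasSum_creation_dirDeriv hΦ hgen e h q
  refine eq_of_isSelfAdjoint_of_le (isSelfAdjoint_adjMulClosure hΦ hgen e) ?_ ?_
  · refine le_opSeries (S := numberOpPoly Φ e) (fun i =>
      (isSelfAdjoint_opMul_adjoint_closure (hdense i) (hclos i)).isClosed) ?_ hdom ?_ hsum
    · exact graph_le_closure_of_dense (numberOpPoly_le hΦ hgen e)
        (opMul_adjoint_closure_nonneg (dense_malliavin_domain hΦ hgen e)
          (isClosable_malliavin hΦ hgen e)) (dense_range_add_numberOpPoly hΦ hgen e)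
    · intro s x
      refine norm_sum_le_of_hasSum_of_inner_nonneg (hsum x) (fun i j => ?_) s
      obtain ⟨n, h, q, -, h3⟩ := hval x
      rw [h3, h3]
      by_cases hij : i = j
      · subst hij
        exact real_inner_self_nonneg
      · exact inner_creation_dirDeriv_nonneg hΦ (e.orthonormal.2 (Ne.symm hij)) _
  · exact opSeries_isFormalAdjoint fun i =>
      opMul_adjoint_closure_isFormalAdjoint (hdense i) (hclos i)

end Malliavin

/-! ### The value on exponentials. -/

section Exponential

open MvPolynomial Filter
open scoped Topology

variable {L Ω : Type*} [NormedAddCommGroup L] [InnerProductSpace ℝ L] [MeasurableSpace Ω]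
  {P : Measure Ω} {Φ : L →ₗ[ℝ] Lp ℝ 2 P}

/-- Dominating function for the images of the Taylor polynomials; it is at most `(1 + c) exp (2 |Φ
k|)`. -/
theorem IsGaussianField.memLp_abs_add_mul_exp (hΦ : IsGaussianField Φ) (k : L) {c : ℝ}
    (hc : 0 ≤ c) : MemLp (fun ω => (|Φ k ω| + c) * Real.exp |Φ k ω|) 2 P := by
  have hm := hΦ.gaussian.aemeasurable k
  refine ((hΦ.memLp_exp k 2).const_mul (1 + c)).mono' (by fun_prop)
    (Eventually.of_forall fun ω => ?_)
  have h1 : |Φ k ω| ≤ Real.exp |Φ k ω| := (le_add_of_nonneg_right zero_le_one).trans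
    (Real.add_one_le_exp _)
  have h2 : 1 ≤ Real.exp |Φ k ω| := Real.one_le_exp (abs_nonneg _)
  rw [Real.norm_of_nonneg (by positivity), two_mul, Real.exp_add, ← mul_assoc]
  refine mul_le_mul_of_nonneg_right ?_ (Real.exp_pos _).le
  nlinarith

theorem memLp_sub_mul_exp (hΦ : IsGaussianField Φ) (k : L) :
    MemLp (fun ω => (Φ k ω - ‖k‖ ^ 2) * Real.exp (Φ k ω)) 2 P := by
  have hm := hΦ.gaussian.aemeasurable k
  refine (hΦ.memLp_abs_add_mul_exp k (sq_nonneg ‖k‖)).mono' (by fun_prop)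
    (Eventually.of_forall fun ω => ?_)
  rw [norm_mul, Real.norm_eq_abs, Real.norm_eq_abs, Real.abs_exp]
  refine mul_le_mul ?_ (Real.exp_le_exp.2 (le_abs_self _)) (Real.exp_pos _).le (by positivity)
  refine (abs_sub _ _).trans_eq ?_
  rw [abs_of_nonneg (sq_nonneg ‖k‖)]

/-- The exponential polynomial `∑ m < n, X ^ m / m!`. -/
noncomputable def expPoly {σ : Type*} (i : σ) (n : ℕ) : MvPolynomial σ ℝ :=
  ∑ m ∈ Finset.range n, C (1 / (m.factorial : ℝ)) * X i ^ m

theorem derivation_expPoly {σ : Type*} (D : Derivation ℝ (MvPolynomial σ ℝ) (MvPolynomial σ ℝ))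
    (i : σ) (n : ℕ) : D (expPoly i (n + 1)) = expPoly i n * D (X i) := by
  rw [expPoly, Finset.sum_range_succ', map_add, map_sum, expPoly, Finset.sum_mul]
  have h0 : D (C (1 / ((0 : ℕ).factorial : ℝ)) * X i ^ 0) = 0 := by
    rw [pow_zero, mul_one, MvPolynomial.derivation_C]
  rw [h0, add_zero]
  refine Finset.sum_congr rfl fun m _ => ?_
  have hC : (C (1 / ((m + 1).factorial : ℝ)) * ((m + 1 : ℕ) : MvPolynomial σ ℝ)) =
      C (1 / (m.factorial : ℝ)) := by
    rw [← map_natCast C, ← C_mul, Nat.factorial_succ]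
    congr 1
    push_cast
    field_simp
  rw [Derivation.leibniz, MvPolynomial.derivation_C, smul_zero, add_zero, Derivation.leibniz_pow,
    Nat.add_sub_cancel, smul_eq_mul, smul_eq_mul, nsmul_eq_mul, ← hC]
  ring

theorem rename_expPoly {σ τ : Type*} (f : σ → τ) (i : σ) (n : ℕ) :
    rename f (expPoly i n) = expPoly (f i) n := by
  simp [expPoly]

theorem polyEval_expPoly (k : L) (n : ℕ) (ω : Ω) :
    polyEval Φ (expPoly k n) ω = ∑ m ∈ Finset.range n, (Φ k ω) ^ m / (m.factorial : ℝ) := by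
  simp [polyEval, expPoly, div_eq_inv_mul]

theorem abs_polyEval_expPoly_le (k : L) (n : ℕ) (ω : Ω) :
    |polyEval Φ (expPoly k n) ω| ≤ Real.exp |Φ k ω| := by
  rw [polyEval_expPoly]
  refine (Finset.abs_sum_le_sum_abs _ _).trans ?_
  simp only [abs_div, abs_pow, Nat.abs_cast]
  exact Real.sum_le_exp_of_nonneg (abs_nonneg _) n

theorem tendsto_polyEval_expPoly (k : L) (ω : Ω) :
    Tendsto (fun n => polyEval Φ (expPoly k n) ω) atTop (𝓝 (Real.exp (Φ k ω))) := by
  simp only [polyEval_expPoly]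
  rw [Real.exp_eq_exp_ℝ]
  exact (NormedSpace.expSeries_div_hasSum_exp (Φ k ω)).tendsto_sum_nat

theorem polyEval_creation_expPoly (k : L) (n : ℕ) (ω : Ω) :
    polyEval Φ (creation k (expPoly k (n + 1))) ω =
      Φ k ω * polyEval Φ (expPoly k (n + 1)) ω - ‖k‖ ^ 2 * polyEval Φ (expPoly k n) ω := by
  rw [creation_apply, derivation_expPoly, dirDeriv_X, real_inner_self_eq_norm_sq]
  simp [polyEval, mul_comm]

theorem exp_mem_graph_adjMulClosure [CompleteSpace L] (hΦ : IsGaussianField Φ)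
    (hgen : GeneratesSigmaAlgebra Φ) (e : HilbertBasis ℕ ℝ L) (k : L) :
    ∃ F G : Lp ℝ 2 P, F =ᵐ[P] (fun ω => Real.exp (Φ k ω)) ∧
      G =ᵐ[P] (fun ω => (Φ k ω - ‖k‖ ^ 2) * Real.exp (Φ k ω)) ∧
      (F, G) ∈ (adjMulClosure Φ).graph := by
  have hm := hΦ.gaussian.aemeasurable k
  have hE : MemLp (fun ω => Real.exp |Φ k ω|) 2 P := by simpa using hΦ.memLp_exp k 1
  have hF : MemLp (fun ω => Real.exp (Φ k ω)) 2 P :=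
    hE.mono' (by fun_prop) (Eventually.of_forall fun ω => by
      rw [Real.norm_eq_abs, Real.abs_exp]
      exact Real.exp_le_exp.2 (le_abs_self _))
  have hG := memLp_sub_mul_exp hΦ k
  refine ⟨hF.toLp, hG.toLp, hF.coeFn_toLp, hG.coeFn_toLp, ?_⟩
  -- The shift by two pays for two derivatives, one in `T` and one in `creation k`, each of which
  -- removes a Taylor term.
  have h1 : Tendsto (fun n => polyLp hΦ (expPoly k (n + 2))) atTop (𝓝 hF.toLp) :=
    tendsto_polyLp hΦ _ hE (fun n ω => abs_polyEval_expPoly_le k _ ω)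
      (fun ω => (tendsto_polyEval_expPoly k ω).comp (tendsto_add_atTop_nat 2)) _ hF.coeFn_toLp
  have h2 : Tendsto (fun n => polyLp hΦ (creation k (expPoly k (n + 1)))) atTop (𝓝 hG.toLp) := by
    refine tendsto_polyLp hΦ _ (hΦ.memLp_abs_add_mul_exp k (sq_nonneg ‖k‖)) (fun n ω => ?_)
      (fun ω => ?_) _ hG.coeFn_toLp
    · rw [polyEval_creation_expPoly, add_mul]
      refine (abs_sub _ _).trans (add_le_add ?_ ?_)
      · rw [abs_mul]
        exact mul_le_mul_of_nonneg_left (abs_polyEval_expPoly_le k _ ω) (abs_nonneg _)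
      · rw [abs_mul, abs_of_nonneg (sq_nonneg ‖k‖)]
        exact mul_le_mul_of_nonneg_left (abs_polyEval_expPoly_le k _ ω) (sq_nonneg _)
    · simp only [polyEval_creation_expPoly, sub_mul]
      exact (((tendsto_polyEval_expPoly k ω).comp (tendsto_add_atTop_nat 1)).const_mul _).sub
        ((tendsto_polyEval_expPoly k ω).const_mul _)
  refine (isSelfAdjoint_adjMulClosure hΦ hgen e).isClosed.mem_of_tendsto (h1.prodMk_nhds h2)
    (Eventually.of_forall fun n => ?_)
  have := mem_graph_adjMulClosure hΦ hgen e (fun _ : Fin 1 => k) (expPoly 0 (n + 2))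
  rw [rename_expPoly, Fin.sum_univ_one, derivation_expPoly, pderiv_X_self, mul_one,
    rename_expPoly] at this
  exact this

end Exponential

end GaussianField

theorem mainTheorem6 {L : Type*} [NormedAddCommGroup L] [InnerProductSpace ℝ L] [CompleteSpace L]
    {Ω : Type*} [MeasurableSpace Ω] (P : Measure Ω) [IsProbabilityMeasure P]
    (Φ : L →ₗ[ℝ] Lp ℝ 2 P) (hΦ : GaussianField.IsGaussianField Φ)
    (hgen : GaussianField.GeneratesSigmaAlgebra Φ) (e : HilbertBasis ℕ ℝ L) :
    -- the operators are meaningful: `T` is well defined by its formula, densely defined and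
    -- closable, and so are the directional derivatives
    ((∀ (n : ℕ) (h : Fin n → L) (p : MvPolynomial (Fin n) ℝ),
        ∃ F : (GaussianField.malliavin Φ).domain,
          ((F : Lp ℝ 2 P) : Ω → ℝ) =ᵐ[P] GaussianField.polyFun Φ h p ∧
          (GaussianField.malliavin Φ F : Ω → L) =ᵐ[P] GaussianField.polyGrad Φ h p) ∧
      Dense ((GaussianField.malliavin Φ).domain : Set (Lp ℝ 2 P)) ∧
      (GaussianField.malliavin Φ).IsClosable ∧
      ∀ k : L, (GaussianField.malliavinDir Φ k).IsClosable) ∧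
    -- `T* T̄` is selfadjoint
    IsSelfAdjoint (GaussianField.adjMulClosure Φ) ∧
    -- `T* T̄ = N`, including equality of domains
    GaussianField.adjMulClosure Φ = GaussianField.numberOp Φ e ∧
    -- `∑ i, T_{eᵢ}* T_{eᵢ}` converges on all of `𝒟`, and its closure is the same operator
    ((GaussianField.numberOpPoly Φ e).domain = (GaussianField.malliavin Φ).domain ∧
      (GaussianField.numberOpPoly Φ e).IsClosable ∧
      (GaussianField.numberOpPoly Φ e).closure = GaussianField.adjMulClosure Φ) ∧
    -- the value on exponentials
    ∀ k : L, ∃ F G : Lp ℝ 2 P,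
      (F : Ω → ℝ) =ᵐ[P] (fun ω => Real.exp (Φ k ω)) ∧
      (G : Ω → ℝ) =ᵐ[P] (fun ω => (Φ k ω - ‖k‖ ^ 2) * Real.exp (Φ k ω)) ∧
      (F, G) ∈ (GaussianField.adjMulClosure Φ).graph ∧
      (F, G) ∈ (GaussianField.numberOp Φ e).graph := by
  have hd := GaussianField.dense_malliavin_domain hΦ hgen e
  have heq := GaussianField.adjMulClosure_eq_numberOp hΦ hgen e
  refine ⟨⟨fun n h p => ?_, hd, GaussianField.isClosable_malliavin hΦ hgen e,
    GaussianField.isClosable_malliavinDir hΦ hgen e⟩,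
    GaussianField.isSelfAdjoint_adjMulClosure hΦ hgen e, heq,
    ⟨GaussianField.numberOpPoly_domain hΦ hgen e, GaussianField.closure_numberOpPoly hΦ hgen e⟩,
    fun k => ?_⟩
  · have hp := (GaussianField.mem_malliavin_domain_iff hΦ hgen e).2 ⟨MvPolynomial.rename h p, rfl⟩
    refine ⟨⟨_, hp⟩, ?_, ?_⟩
    · rw [GaussianField.polyFun_eq_polyEval]
      exact GaussianField.coeFn_polyLp hΦ _
    · rw [GaussianField.malliavin_rename hΦ hgen e]
      exact GaussianField.coeFn_sum_tensor hΦ h p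
  · obtain ⟨F, G, hF, hG, hFG⟩ := GaussianField.exp_mem_graph_adjMulClosure hΦ hgen e k
    exact ⟨F, G, hF, hG, hFG, heq ▸ hFG⟩
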